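/- Let $V$ be a vertex operator algebra over $\mathbb{C}$: it is $\mathbb{Z}$-graded by the eigenvalues of $L(0)$, with finite-dimensional weight spaces $V_n$ that vanish for $n$ sufficiently negative. By a $V$-module $W$ we mean a module graded by the $L(0)$-eigenvalues $h\in\mathbb{C}$, $W=\coprod_{h\in\mathbb{C}}W_h$, with finite-dimensional weight spaces $W_h$ that vanish when the real part of $h$ is sufficiently negative. Write $Y^o_W(v,x)=Y_W(e^{xL(1)}(-x^{-2})^{L(0)}v,x^{-1})$ for the opposite vertex operator. The contragredient $W'$ of $W$ is the graded dual $\coprod_h W_h^*$ with vertex operators given by $\langle Y_{W'}(v,x)w',w\rangle=\langle w',Y^o_W(v,x)w\rangle$. A bilinear pairing $(\cdot,\cdot)$ between $V$-modules $W^{(1)}$ and $W^{(2)}$ is called invariant if $$(Y_{W^{(1)}}(v,x)w_{(1)},w_{(2)})=(w_{(1)},Y^o_{W^{(2)}}(v,x)w_{(2)})$$ for all $v\in V$, $w_{(1)}\in W^{(1)}$, $w_{(2)}\in W^{(2)}$. Suppose $V$ has a nondegenerate invariant bilinear form $(\cdot,\cdot)_V$, let $W^{(1)}$ and $W^{(2)}$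 be $V$-modules, and let $\mathcal{Y}$ be an intertwining operator of type $\binom{V}{W^{(1)}\,W^{(2)}}$. Put $$\mathcal{Y}^o_0(w_{(1)},x)w_{(2)}=\mathcal{Y}(e^{xL(1)}e^{\pi i L(0)}(x^{-L(0)})^2w_{(1)},x^{-1})w_{(2)},$$ and let $\mathcal{Y}^o_0(w_{(1)},e^{\pi i}x)$ be obtained from $\mathcal{Y}^o_0(w_{(1)},x)$ by replacing $x^p$ by $e^{\pi i p}x^p$ for every $p\in\mathbb{C}$. Then $$(w_{(1)},w_{(2)})=\mathrm{Res}_x\,x^{-1}\,(\mathbf{1},\mathcal{Y}^o_0(w_{(1)},e^{\pi i}x)\,e^{xL(1)}w_{(2)})_V$$ defines an invariant bilinear pairing between $W^{(1)}$ and $W^{(2)}$. If moreover $W^{(1)}$ and $W^{(2)}$ are irreducible and $\mathcal{Y}\neq 0$, then this pairing is nondegenerate, and $W^{(1)}$ and $W^{(2)}$ form a contragredient pair, that is, $W^{(1)}\cong (W^{(2)})'$ and $W^{(2)}\cong (W^{(1)})'$ as $V$-modules. -/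

import Mathlib

noncomputable section

namespace VOA

open Module

/-! ### The Jacobi identity, in modes

For `Y(v,x) = ∑ aᵢ(n) x^{-n-1}` acting on `Wᵢ` (`n ∈ ℤ`) and `I(w,x) = ∑ I w n x^{-n-1}`
(`n ∈ A`, with `A = ℤ` or `A = ℂ`), this is the equality of the coefficients of
`x₀^{-l-1} x₁^{-m-1} x₂^{-n-1}` in
`x₀⁻¹ δ((x₁-x₂)/x₀) Y(v,x₁) I(w₁,x₂) w₂ - x₀⁻¹ δ((x₂-x₁)/(-x₀)) I(w₁,x₂) Y(v,x₁) w₂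
  = x₂⁻¹ δ((x₁-x₀)/x₂) I(Y(v,x₀) w₁, x₂) w₂`.
All the sums are finite whenever `aᵢ` and `I` are lower truncated. -/
def JacobiIdentity {A W₁ W₂ W₃ : Type*} [AddCommGroupWithOne A]
    [AddCommGroup W₁] [Module ℂ W₁] [AddCommGroup W₂] [Module ℂ W₂]
    [AddCommGroup W₃] [Module ℂ W₃]
    (a₁ : ℤ → End ℂ W₁) (a₂ : ℤ → End ℂ W₂) (a₃ : ℤ → End ℂ W₃)
    (I : W₁ → A → W₂ →ₗ[ℂ] W₃) : Prop :=
  ∀ (w₁ : W₁) (w₂ : W₂) (l m : ℤ) (n : A),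
    (∑ᶠ i : ℕ, ((-1 : ℂ) ^ i * ((Ring.choose l i : ℤ) : ℂ)) •
        a₃ (m + l - i) (I w₁ (n + (i : A)) w₂))
      - (-1 : ℂ) ^ l • (∑ᶠ i : ℕ, ((-1 : ℂ) ^ i * ((Ring.choose l i : ℤ) : ℂ)) •
        I w₁ (n + (l : A) - (i : A)) (a₂ (m + i) w₂))
    = ∑ᶠ i : ℕ, ((Ring.choose m i : ℤ) : ℂ) • I (a₁ (l + i) w₁) ((m : A) + n - (i : A)) w₂

/-- A vertex operator algebra structure on the complex vector space `V`. The operator `L(n)` is the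
mode `ω_{n+1}`, and the weight space `V_n` is the eigenspace of `L(0)` for the eigenvalue `n`. The
lower truncation axiom is part of the type of `Y`. -/
structure VertexOperatorAlgebra (V : Type*) [AddCommGroup V] [Module ℂ V] where
  /-- the vertex operator map `v ↦ Y(v, x)` -/
  Y : V →ₗ[ℂ] VertexOperator ℂ V
  /-- the vacuum vector -/
  vac : V
  /-- the conformal vector -/
  conf : V
  /-- the central charge -/
  c : ℂ
  vacuum : ∀ (n : ℤ) (v : V), VertexOperator.ncoeff (Y vac) n v = if n = -1 then v else 0
  creation_nonneg : ∀ (v : V) (n : ℤ), 0 ≤ n → VertexOperator.ncoeff (Y v) n vac = 0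
  creation : ∀ v : V, VertexOperator.ncoeff (Y v) (-1) vac = v
  jacobi : ∀ u : V, JacobiIdentity (VertexOperator.ncoeff (Y u)) (VertexOperator.ncoeff (Y u))
    (VertexOperator.ncoeff (Y u)) (fun v => VertexOperator.ncoeff (Y v))
  virasoro : ∀ (m n : ℤ) (v : V),
    VertexOperator.ncoeff (Y conf) (m + 1) (VertexOperator.ncoeff (Y conf) (n + 1) v)
      - VertexOperator.ncoeff (Y conf) (n + 1) (VertexOperator.ncoeff (Y conf) (m + 1) v)
    = ((m : ℂ) - n) • VertexOperator.ncoeff (Y conf) (m + n + 1) v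
      + (if m + n = 0 then ((m : ℂ) ^ 3 - m) / 12 * c else 0) • v
  graded : DirectSum.IsInternal
    (fun n : ℤ => End.eigenspace (VertexOperator.ncoeff (Y conf) 1) (n : ℂ))
  finite_dim : ∀ n : ℤ,
    FiniteDimensional ℂ (End.eigenspace (VertexOperator.ncoeff (Y conf) 1) (n : ℂ))
  bounded_below : ∃ N : ℤ, ∀ n : ℤ, n < N →
    End.eigenspace (VertexOperator.ncoeff (Y conf) 1) (n : ℂ) = ⊥
  vac_mem : vac ∈ End.eigenspace (VertexOperator.ncoeff (Y conf) 1) (0 : ℂ)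
  conf_mem : conf ∈ End.eigenspace (VertexOperator.ncoeff (Y conf) 1) (2 : ℂ)
  /-- `Y(L(-1)v, x) = d/dx Y(v, x)` -/
  deriv : ∀ (v : V) (n : ℤ), VertexOperator.ncoeff (Y (VertexOperator.ncoeff (Y conf) 0 v)) n
    = (-(n : ℂ)) • VertexOperator.ncoeff (Y v) (n - 1)

/-- A module for a vertex operator algebra, on the complex vector space `W`: a module for `V` as a
vertex algebra, graded by the `L(0)`-eigenvalues `h ∈ ℂ`, with finite-dimensional weight spaces
that vanish when the real part of `h` is sufficiently negative. -/
structure VOAModule {V : Type*} [AddCommGroup V] [Module ℂ V] (𝒱 : VertexOperatorAlgebra V)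
    (W : Type*) [AddCommGroup W] [Module ℂ W] where
  /-- the vertex operator map `v ↦ Y_W(v, x)` -/
  Y : V →ₗ[ℂ] VertexOperator ℂ W
  vacuum : ∀ (n : ℤ) (w : W), VertexOperator.ncoeff (Y 𝒱.vac) n w = if n = -1 then w else 0
  jacobi : ∀ u : V, JacobiIdentity (VertexOperator.ncoeff (𝒱.Y u)) (VertexOperator.ncoeff (Y u))
    (VertexOperator.ncoeff (Y u)) (fun v => VertexOperator.ncoeff (Y v))
  graded : DirectSum.IsInternal
    (fun h : ℂ => End.eigenspace (VertexOperator.ncoeff (Y 𝒱.conf) 1) h)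
  finite_dim : ∀ h : ℂ,
    FiniteDimensional ℂ (End.eigenspace (VertexOperator.ncoeff (Y 𝒱.conf) 1) h)
  bounded_below : ∃ N : ℝ, ∀ h : ℂ, h.re < N →
    End.eigenspace (VertexOperator.ncoeff (Y 𝒱.conf) 1) h = ⊥

section Adjoint

variable {V : Type*} [AddCommGroup V] [Module ℂ V] (𝒱 : VertexOperatorAlgebra V)

theorem VertexOperatorAlgebra.iSup_eq_top :
    ⨆ h : ℂ, End.eigenspace (VertexOperator.ncoeff (𝒱.Y 𝒱.conf) 1) h = ⊤ := by
  rw [eq_top_iff, ← 𝒱.graded.submodule_iSup_eq_top]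
  exact iSup_le fun n => le_iSup
    (fun h : ℂ => End.eigenspace (VertexOperator.ncoeff (𝒱.Y 𝒱.conf) 1) h) (n : ℂ)

theorem VertexOperatorAlgebra.eigenspace_eq_bot {h : ℂ} (hh : ∀ n : ℤ, (n : ℂ) ≠ h) :
    End.eigenspace (VertexOperator.ncoeff (𝒱.Y 𝒱.conf) 1) h = ⊥ := by
  have hd := End.eigenspaces_iSupIndep (VertexOperator.ncoeff (𝒱.Y 𝒱.conf) 1) h
  rw [← disjoint_top, ← 𝒱.graded.submodule_iSup_eq_top]
  refine hd.mono_right (iSup_le fun n => ?_)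
  exact le_iSup₂ (f := fun (j : ℂ) (_ : j ≠ h) =>
    End.eigenspace (VertexOperator.ncoeff (𝒱.Y 𝒱.conf) 1) j) (n : ℂ) (hh n)

/-- `V` as a module for itself. -/
def VertexOperatorAlgebra.adjoint : VOAModule 𝒱 V where
  Y := 𝒱.Y
  vacuum := 𝒱.vacuum
  jacobi := 𝒱.jacobi
  graded := (DirectSum.isInternal_submodule_iff_iSupIndep_and_iSup_eq_top _).2
    ⟨End.eigenspaces_iSupIndep _, 𝒱.iSup_eq_top⟩
  finite_dim := fun h => by
    by_cases hh : ∃ n : ℤ, (n : ℂ) = h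
    · obtain ⟨n, rfl⟩ := hh
      exact 𝒱.finite_dim n
    · push Not at hh
      rw [𝒱.eigenspace_eq_bot hh]
      infer_instance
  bounded_below := by
    obtain ⟨N, hN⟩ := 𝒱.bounded_below
    refine ⟨N, fun h hlt => ?_⟩
    by_cases hh : ∃ n : ℤ, (n : ℂ) = h
    · obtain ⟨n, rfl⟩ := hh
      exact hN n (by simpa using hlt)
    · push Not at hh
      exact 𝒱.eigenspace_eq_bot hh

end Adjoint

namespace VOAModule

variable {V : Type*} [AddCommGroup V] [Module ℂ V] {𝒱 : VertexOperatorAlgebra V}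
variable {W : Type*} [AddCommGroup W] [Module ℂ W] (M : VOAModule 𝒱 W)

/-- The mode `v_n`, where `Y_W(v, x) = ∑ v_n x^{-n-1}`. -/
def mode (v : V) (n : ℤ) : End ℂ W := VertexOperator.ncoeff (M.Y v) n

/-- The Virasoro operator `L(n) = ω_{n+1}`. -/
def L (n : ℤ) : End ℂ W := M.mode 𝒱.conf (n + 1)

/-- The weight space `W_h`. -/
def wtSpace (h : ℂ) : Submodule ℂ W :=
  End.eigenspace (VertexOperator.ncoeff (M.Y 𝒱.conf) 1) h

/-- The projection of `W = ⨁ W_h` onto the weight space `W_h`. -/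
def wtProj (h : ℂ) : W →ₗ[ℂ] W :=
  (M.wtSpace h).subtype ∘ₗ DirectSum.component ℂ ℂ (fun k => M.wtSpace k) h ∘ₗ
    (LinearEquiv.ofBijective (DirectSum.coeLinearMap fun k => M.wtSpace k) M.graded).symm

/-- The mode `v^o_n` of the opposite vertex operator
`Y_W^o(v, x) = Y_W(e^{xL(1)} (-x^{-2})^{L(0)} v, x^{-1}) = ∑ v^o_n x^{-n-1}`. For `v ∈ V_j` this is
`∑_k (-1)^j (1/k!) (L(1)^k v)_{2j-k-n-2}`. -/
def oppMode (v : V) (n : ℤ) : End ℂ W :=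
  ∑ᶠ j : ℤ, (-1 : ℂ) ^ j • ∑ᶠ k : ℕ, (1 / (k.factorial : ℂ)) •
    M.mode ((𝒱.adjoint.L 1 ^ k) (𝒱.adjoint.wtProj (j : ℂ) v)) (2 * j - k - n - 2)

/-- Irreducibility: `W ≠ 0` and the only submodules are `0` and `W`. -/
def IsIrreducible : Prop :=
  Nontrivial W ∧ ∀ U : Submodule ℂ W,
    (∀ (v : V) (n : ℤ), ∀ w ∈ U, M.mode v n w ∈ U) → U = ⊥ ∨ U = ⊤

/-- The graded dual `W' = ⨁ W_h^*`: the linear functionals on `W = ⨁ W_h` that vanish on all but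
finitely many of the weight spaces. -/
def gradedDual : Submodule ℂ (Dual ℂ W) where
  carrier := {f | {h : ℂ | ∃ w ∈ M.wtSpace h, f w ≠ 0}.Finite}
  zero_mem' := by simp
  add_mem' := by
    intro f g hf hg
    refine (hf.union hg).subset ?_
    rintro h ⟨w, hw, hne⟩
    by_cases h0 : f w = 0
    · exact Or.inr ⟨w, hw, fun hg0 => hne (by simp [h0, hg0])⟩
    · exact Or.inl ⟨w, hw, h0⟩
  smul_mem' := by
    intro a f hf
    refine hf.subset ?_
    rintro h ⟨w, hw, hne⟩
    exact ⟨w, hw, fun h0 => hne (by simp [h0])⟩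

/-- The modes of the contragredient vertex operator, defined by
`⟨Y_{W'}(v,x) w', w⟩ = ⟨w', Y_W^o(v,x) w⟩`. -/
def contraMode (v : V) (n : ℤ) (f : Dual ℂ W) : Dual ℂ W := f ∘ₗ M.oppMode v n

/-- `W₁` is isomorphic, as a `V`-module, to the contragredient module of `W₂`. -/
def IsoContragredient {W₁ W₂ : Type*} [AddCommGroup W₁] [Module ℂ W₁] [AddCommGroup W₂]
    [Module ℂ W₂] (M₁ : VOAModule 𝒱 W₁) (M₂ : VOAModule 𝒱 W₂) : Prop :=
  ∃ φ : W₁ ≃ₗ[ℂ] M₂.gradedDual, ∀ (v : V) (n : ℤ) (w : W₁),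
    (φ (M₁.mode v n w) : Dual ℂ W₂) = M₂.contraMode v n (φ w : Dual ℂ W₂)

/-- `W₁` and `W₂` form a contragredient pair: each is isomorphic to the contragredient of the
other. -/
def IsContragredientPair {W₁ W₂ : Type*} [AddCommGroup W₁] [Module ℂ W₁] [AddCommGroup W₂]
    [Module ℂ W₂] (M₁ : VOAModule 𝒱 W₁) (M₂ : VOAModule 𝒱 W₂) : Prop :=
  IsoContragredient M₁ M₂ ∧ IsoContragredient M₂ M₁

/-- Invariance of a bilinear pairing:
`(Y_{W₁}(v,x) w₁, w₂) = (w₁, Y_{W₂}^o(v,x) w₂)`. -/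
def IsInvariant {W₁ W₂ : Type*} [AddCommGroup W₁] [Module ℂ W₁] [AddCommGroup W₂]
    [Module ℂ W₂] (M₁ : VOAModule 𝒱 W₁) (M₂ : VOAModule 𝒱 W₂) (B : W₁ →ₗ[ℂ] W₂ →ₗ[ℂ] ℂ) : Prop :=
  ∀ (v : V) (n : ℤ) (w₁ : W₁) (w₂ : W₂), B (M₁.mode v n w₁) w₂ = B w₁ (M₂.oppMode v n w₂)

end VOAModule

/-- An intertwining operator of type `W₃` over `W₁ W₂`. Here `coeff w n` is the mode `w_n`, where
`I(w, x) = ∑_{n ∈ ℂ} w_n x^{-n-1}`. -/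
structure IntertwiningOperator {V W₁ W₂ W₃ : Type*} [AddCommGroup V] [Module ℂ V]
    [AddCommGroup W₁] [Module ℂ W₁] [AddCommGroup W₂] [Module ℂ W₂] [AddCommGroup W₃] [Module ℂ W₃]
    {𝒱 : VertexOperatorAlgebra V}
    (M₁ : VOAModule 𝒱 W₁) (M₂ : VOAModule 𝒱 W₂) (M₃ : VOAModule 𝒱 W₃) where
  coeff : W₁ →ₗ[ℂ] (ℂ → (W₂ →ₗ[ℂ] W₃))
  truncation : ∀ (w₁ : W₁) (w₂ : W₂) (n : ℂ), ∃ N : ℕ, ∀ m : ℕ, N ≤ m → coeff w₁ (n + m) w₂ = 0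
  jacobi : ∀ v : V, JacobiIdentity (M₁.mode v) (M₂.mode v) (M₃.mode v) (fun w₁ => coeff w₁)
  /-- `I(L(-1)w, x) = d/dx I(w, x)` -/
  deriv : ∀ (w₁ : W₁) (n : ℂ), coeff (M₁.L (-1) w₁) n = (-n) • coeff w₁ (n - 1)

/-! ### Formal series with complex powers

A formal series `f = ∑_{p ∈ ℂ} f_p x^p` is the function `p ↦ f_p`. -/

/-- `Res_x f`, the coefficient of `x⁻¹`. -/
def formalRes {E : Type*} (f : ℂ → E) : E := f (-1)

/-- `x^a f(x)`. -/
def mulXPow {E : Type*} (a : ℂ) (f : ℂ → E) : ℂ → E := fun p => f (p - a)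

/-- `f(e^ζ x)`, where `(e^ζ x)^p = e^{ζ p} x^p`. -/
def substExp {E : Type*} [AddCommGroup E] [Module ℂ E] (ζ : ℂ) (f : ℂ → E) : ℂ → E :=
  fun p => Complex.exp (ζ * p) • f p

namespace IntertwiningOperator

variable {V W₁ W₂ W₃ : Type*} [AddCommGroup V] [Module ℂ V]
  [AddCommGroup W₁] [Module ℂ W₁] [AddCommGroup W₂] [Module ℂ W₂] [AddCommGroup W₃] [Module ℂ W₃]
  {𝒱 : VertexOperatorAlgebra V}
  {M₁ : VOAModule 𝒱 W₁} {M₂ : VOAModule 𝒱 W₂} {M₃ : VOAModule 𝒱 W₃}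

/-- The series `I^o_r(w, x) = I(e^{xL(1)} e^{(2r+1)πi L(0)} (x^{-L(0)})² w, x⁻¹)`; the value at `p`
is the coefficient of `x^p`. For `w` of weight `h` this coefficient is
`∑_k e^{(2r+1)πi h} (1/k!) (L(1)^k w)_{p-1-k+2h}`. -/
def opp (I : IntertwiningOperator M₁ M₂ M₃) (r : ℤ) (w : W₁) : ℂ → (W₂ →ₗ[ℂ] W₃) := fun p =>
  ∑ᶠ h : ℂ, Complex.exp ((2 * r + 1) * Real.pi * Complex.I * h) •
    ∑ᶠ k : ℕ, (1 / (k.factorial : ℂ)) •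
      I.coeff ((M₁.L 1 ^ k) (M₁.wtProj h w)) (p - 1 - k + 2 * h)

/-- For `I` with values in `V` and a bilinear form `(·,·)_V` on `V`, the formal series
`(𝟏, I^o_0(w₁, e^{πi} x) e^{xL(1)} w₂)_V`. -/
def contSeries (I : IntertwiningOperator M₁ M₂ 𝒱.adjoint) (form : V →ₗ[ℂ] V →ₗ[ℂ] ℂ)
    (w₁ : W₁) (w₂ : W₂) : ℂ → ℂ := fun p =>
  ∑ᶠ j : ℕ, form 𝒱.vac
    (substExp (Real.pi * Complex.I) (I.opp 0 w₁) (p - j)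
      ((1 / (j.factorial : ℂ)) • (M₂.L 1 ^ j) w₂))

/-- `Res_x x⁻¹ (𝟏, I^o_0(w₁, e^{πi} x) e^{xL(1)} w₂)_V`. -/
def contForm (I : IntertwiningOperator M₁ M₂ 𝒱.adjoint) (form : V →ₗ[ℂ] V →ₗ[ℂ] ℂ)
    (w₁ : W₁) (w₂ : W₂) : ℂ :=
  formalRes (mulXPow (-1) (I.contSeries form w₁ w₂))

end IntertwiningOperator

end VOA

end

/-! Put λ = (𝟏, ·)_V. Since v_n 𝟏 = 0 for n ≥ 0, invariance of the form gives λ ∘ v^o_n = 0 for n ≥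
0 (`isVacuumFunctional_form`), and the proof of invariance needs nothing else about the form. For v
= ω and n = 1 it says λ ∘ L(0) = 0, so λ is supported on V_0. For homogeneous w₁, w₂ the series
λ(I(w₁, x) w₂) is therefore at most one monomial and can be evaluated at x = 1 (`twoPoint`).
Unwinding the residue, for w₁ of weight h the pairing is e^{πih} λ(I(e^{L(1)} w₁, 1) e^{-L(1)} w₂)
(`expPairing`, `contPairing_of_mem`).

Invariance: moving v_l past e^{L(1)} on the left and v^o_l past e^{-L(1)} on the right produces
explicit binomial sums (`expL_mode`, `expL_neg_oppSum`). These are two of the three terms of the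
Jacobi identity for the vectors L(1)^s v / s!, summed over s. The remaining term is a sum of values
λ(v^o_i u) with i ≥ 0, up to sign, and vanishes (`twoPoint_conjMode_of_mem`). The factor e^{πih}
supplies the correct sign.

Nonvanishing: if the pairing is zero, invertibility of e^{±L(1)} makes λ vanish on all coefficients
of I. By the commutator formula λ also vanishes on their images under all modes. As (v, u) is a
combination of values of λ on modes applied to u, nondegeneracy of the form forces I = 0
(`contPairing_ne_zero`).

Nondegeneracy: the left kernel of an invariant pairing is a submodule. Passing to the opposite
operator is an involution, so the flipped pairing is invariant too (`IsInvariant.flip`) and the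
right kernel is treated the same way. Distinct weights are orthogonal and weight spaces are finite
dimensional, so a nondegenerate invariant pairing identifies each module with the graded dual of the
other. -/

noncomputable section

namespace VOA

open Module

/-! ### Finite double sums -/

section FiniteSums

variable {E : Type*} [AddCommMonoid E]

theorem hasFiniteSupport_of_forall_ge {f : ℕ → E} {N : ℕ} (h : ∀ n, N ≤ n → f n = 0) :
    f.HasFiniteSupport := by
  refine (Set.finite_lt_nat N).subset fun n hn => ?_
  by_contra hlt
  exact hn (h n (not_lt.1 hlt))

theorem finsum_eq_sum_range {f : ℕ → E} {N : ℕ} (h : ∀ n, N ≤ n → f n = 0) :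
    ∑ᶠ n, f n = ∑ n ∈ Finset.range N, f n := by
  refine finsum_eq_sum_of_support_subset f fun n hn => ?_
  by_contra hlt
  exact hn (h n (by simpa using hlt))

/-- The asymmetry is that of the double sums below: a power L(1)^q kills a vector once q is large,
uniformly in p, while truncation of modes in p depends on q. -/
theorem hasFiniteSupport_prod {f : ℕ → ℕ → E} {Q : ℕ} (hQ : ∀ p q, Q ≤ q → f p q = 0)
    (hP : ∀ q, ∃ P, ∀ p, P ≤ p → f p q = 0) :
    (fun x : ℕ × ℕ => f x.1 x.2).HasFiniteSupport := by
  choose P hP using hP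
  refine ((Set.finite_lt_nat Q).biUnion (t := fun q => (fun p => (p, q)) '' {p | p < P q})
    fun q _ => (Set.finite_lt_nat (P q)).image _).subset ?_
  rintro ⟨p, q⟩ hpq
  simp only [Set.mem_iUnion]
  refine ⟨q, ?_, p, ?_, rfl⟩
  · by_contra h
    exact hpq (hQ p q (not_lt.1 h))
  · by_contra h
    exact hpq (hP q p (not_lt.1 h))

theorem finsum_sum_antidiagonal {f : ℕ → ℕ → E}
    (hf : (fun x : ℕ × ℕ => f x.1 x.2).HasFiniteSupport) :
    ∑ᶠ n, ∑ p ∈ Finset.HasAntidiagonal.antidiagonal n, f p.1 p.2 = ∑ᶠ p, ∑ᶠ q, f p q := by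
  classical
  rw [← finsum_curry (fun x : ℕ × ℕ => f x.1 x.2) hf]
  have hf' : (Function.support fun x : ℕ × ℕ => f x.1 x.2).Finite := hf
  have hS : Function.support (fun x : ℕ × ℕ => f x.1 x.2) ⊆ hf'.toFinset := by
    rw [Set.Finite.coe_toFinset]
  rw [finsum_eq_sum_of_support_subset _ hS,
    ← finsum_sum_filter (fun x : ℕ × ℕ => x.1 + x.2) hf'.toFinset (fun x => f x.1 x.2)]
  refine finsum_congr fun n => ?_
  symm
  refine Finset.sum_subset (fun x hx => ?_) (fun x hx hx' => ?_)
  · simpa using (Finset.mem_filter.1 hx).2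
  · by_contra h
    exact hx' (Finset.mem_filter.2 ⟨hS h, by simpa using hx⟩)

end FiniteSums

/-! ### Exponentials of locally nilpotent operators -/

section LocallyFinite

variable {W W' : Type*} [AddCommGroup W] [Module ℂ W] [AddCommGroup W'] [Module ℂ W']

/-- A sequence of linear maps of which only finitely many are nonzero on each vector. -/
def IsLocallyFinite (f : ℕ → W →ₗ[ℂ] W') : Prop := ∀ w, ∃ N, ∀ n, N ≤ n → f n w = 0

theorem IsLocallyFinite.hasFiniteSupport {f : ℕ → W →ₗ[ℂ] W'} (hf : IsLocallyFinite f) (w : W) :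
    (fun n => f n w).HasFiniteSupport :=
  hasFiniteSupport_of_forall_ge (hf w).choose_spec

theorem IsLocallyFinite.smul {f : ℕ → W →ₗ[ℂ] W'} (hf : IsLocallyFinite f) (c : ℕ → ℂ) :
    IsLocallyFinite fun n => c n • f n := fun w => by
  obtain ⟨N, hN⟩ := hf w
  exact ⟨N, fun n hn => by simp [hN n hn]⟩

/-- The sum of a locally finite sequence of linear maps. -/
def locSum (f : ℕ → W →ₗ[ℂ] W') (hf : IsLocallyFinite f) : W →ₗ[ℂ] W' where
  toFun w := ∑ᶠ n, f n w
  map_add' w w' := by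
    simp only [map_add]
    exact finsum_add_distrib (hf.hasFiniteSupport w) (hf.hasFiniteSupport w')
  map_smul' c w := by simp only [map_smul, smul_finsum, RingHom.id_apply]

theorem locSum_apply (f : ℕ → W →ₗ[ℂ] W') (hf : IsLocallyFinite f) (w : W) :
    locSum f hf w = ∑ᶠ n, f n w := rfl

/-- The exponential `e^{xL}` of a locally nilpotent operator. -/
def locExp (L : End ℂ W) (hL : IsLocallyFinite fun k => L ^ k) (x : ℂ) : End ℂ W :=
  locSum (fun k => (x ^ k * (1 / (k.factorial : ℂ))) • L ^ k) (hL.smul _)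

theorem locExp_apply (L : End ℂ W) (hL : IsLocallyFinite fun k => L ^ k) (x : ℂ) (w : W) :
    locExp L hL x w = ∑ᶠ k : ℕ, (x ^ k * (1 / (k.factorial : ℂ))) • (L ^ k) w := rfl

/-- This is the coefficient of x^n in e^{xL} R₀ = (∑ x^k R_k) e^{xL}. After multiplication by n + 1,
each side at n + 1 is L times the same side at n. -/
theorem pow_comp_eq_sum_antidiagonal {L : End ℂ W} {R : ℕ → End ℂ W}
    (hR : ∀ k : ℕ, ((k : ℂ) + 1) • R (k + 1) = L * R k - R k * L) (n : ℕ) :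
    (1 / (n.factorial : ℂ)) • (L ^ n * R 0) =
      ∑ p ∈ Finset.HasAntidiagonal.antidiagonal n, (1 / (p.2.factorial : ℂ)) • (R p.1 * L ^ p.2) := by
  induction n with
  | zero => simp
  | succ n ih =>
    have hn : ((n : ℂ) + 1) ≠ 0 := by exact_mod_cast n.succ_ne_zero
    have hfac : ∀ k : ℕ, (((k + 1).factorial : ℕ) : ℂ) = ((k : ℂ) + 1) * (k.factorial : ℂ) :=
      fun k => by rw [Nat.factorial_succ]; push_cast; ring
    have hf0 : ∀ k : ℕ, (k.factorial : ℂ) ≠ 0 := fun k => by exact_mod_cast k.factorial_ne_zero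
    have hk0 : ∀ k : ℕ, (k : ℂ) + 1 ≠ 0 := fun k => by exact_mod_cast k.succ_ne_zero
    apply smul_right_injective _ hn
    dsimp only
    have h1 : ((n : ℂ) + 1) • (1 / ((n + 1).factorial : ℂ)) • (L ^ (n + 1) * R 0)
        = L * ((1 / (n.factorial : ℂ)) • (L ^ n * R 0)) := by
      rw [smul_smul, hfac, mul_smul_comm, ← mul_assoc, ← pow_succ']
      congr 1
      field_simp [hf0 n]
    rw [h1, ih, Finset.mul_sum]
    have h2 : ∀ p ∈ Finset.HasAntidiagonal.antidiagonal n,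
        L * ((1 / (p.2.factorial : ℂ)) • (R p.1 * L ^ p.2)) =
        (((p.1 + 1 : ℕ) : ℂ) * (1 / (p.2.factorial : ℂ))) • (R (p.1 + 1) * L ^ p.2) +
        (((p.2 + 1 : ℕ) : ℂ) * (1 / ((p.2 + 1).factorial : ℂ))) • (R p.1 * L ^ (p.2 + 1)) := by
      intro p _
      have h3 : L * R p.1 = ((p.1 : ℂ) + 1) • R (p.1 + 1) + R p.1 * L := by
        rw [hR]; abel
      rw [mul_smul_comm, ← mul_assoc, h3, add_mul, smul_add, smul_mul_assoc, smul_smul, mul_assoc,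
        ← pow_succ', mul_comm (1 / (p.2.factorial : ℂ)), hfac]
      push_cast
      congr 2
      field_simp [hf0 p.2, hk0 p.2]
    rw [Finset.sum_congr rfl h2, Finset.sum_add_distrib]
    -- Writing n + 1 = p.1 + p.2 splits the sum in two. Shifting p.1 in one part and p.2 in the
    -- other recovers the two terms of `h2`.
    have h4 : ∀ p ∈ Finset.HasAntidiagonal.antidiagonal (n + 1),
        ((n : ℂ) + 1) • (1 / (p.2.factorial : ℂ)) • (R p.1 * L ^ p.2) =
        ((p.1 : ℂ) * (1 / (p.2.factorial : ℂ))) • (R p.1 * L ^ p.2) +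
        ((p.2 : ℂ) * (1 / (p.2.factorial : ℂ))) • (R p.1 * L ^ p.2) := by
      intro p hp
      have : (n : ℂ) + 1 = p.1 + p.2 := by
        rw [Finset.HasAntidiagonal.mem_antidiagonal] at hp
        exact_mod_cast hp.symm
      rw [smul_smul, this, add_mul, add_smul]
    rw [Finset.smul_sum, Finset.sum_congr rfl h4, Finset.sum_add_distrib]
    congr 1
    · rw [Finset.Nat.sum_antidiagonal_succ]; simp
    · rw [Finset.Nat.sum_antidiagonal_succ']; simp

/-- If `R (k + 1) = [L, R k] / (k + 1)`, then `e^{xL} R₀ = (∑ x^k R_k) e^{xL}`. -/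
theorem locExp_comp {L : End ℂ W} (hL : IsLocallyFinite fun k => L ^ k) {R : ℕ → End ℂ W}
    (hR : ∀ k : ℕ, ((k : ℂ) + 1) • R (k + 1) = L * R k - R k * L) (hfin : IsLocallyFinite R)
    (x : ℂ) (w : W) :
    locExp L hL x (R 0 w) = locSum (fun k => x ^ k • R k) (hfin.smul _) (locExp L hL x w) := by
  obtain ⟨Q, hQ⟩ := hL w
  have hf : (fun y : ℕ × ℕ => (x ^ y.1 • R y.1)
      ((x ^ y.2 * (1 / (y.2.factorial : ℂ))) • (L ^ y.2) w)).HasFiniteSupport := by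
    refine hasFiniteSupport_prod (f := fun p q => (x ^ p • R p)
      ((x ^ q * (1 / (q.factorial : ℂ))) • (L ^ q) w)) (Q := Q) (fun p q hq => ?_) fun q => ?_
    · simp [hQ q hq]
    · obtain ⟨P, hP⟩ := hfin ((L ^ q) w)
      exact ⟨P, fun p hp => by simp [hP p hp]⟩
  rw [locSum_apply, locExp_apply, locExp_apply]
  have h1 : ∀ p : ℕ, (x ^ p • R p) (∑ᶠ k : ℕ, (x ^ k * (1 / (k.factorial : ℂ))) • (L ^ k) w) =
      ∑ᶠ q : ℕ, (x ^ p • R p) ((x ^ q * (1 / (q.factorial : ℂ))) • (L ^ q) w) := fun p =>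
    map_finsum _ (hasFiniteSupport_of_forall_ge (N := Q) fun n hn => by simp [hQ n hn])
  rw [finsum_congr h1, ← finsum_sum_antidiagonal hf]
  refine finsum_congr fun n => ?_
  have h2 := LinearMap.congr_fun (pow_comp_eq_sum_antidiagonal hR n) w
  rw [mul_smul]
  simp only [LinearMap.smul_apply, Module.End.mul_apply, LinearMap.sum_apply] at h2
  rw [h2, Finset.smul_sum]
  refine Finset.sum_congr rfl fun p hp => ?_
  rw [← Finset.HasAntidiagonal.mem_antidiagonal.1 hp, pow_add, LinearMap.smul_apply, map_smul, smul_smul, smul_smul]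
  ring_nf

theorem sum_antidiagonal_exp (n : ℕ) :
    ∑ p ∈ Finset.HasAntidiagonal.antidiagonal n, (1 / (p.1.factorial : ℂ)) *
      ((-1) ^ p.2 * (1 / (p.2.factorial : ℂ))) = if n = 0 then 1 else 0 := by
  have h := congr_arg (PowerSeries.coeff n) (PowerSeries.exp_mul_exp_neg_eq_one (A := ℂ))
  rw [PowerSeries.coeff_mul, PowerSeries.coeff_one] at h
  rw [← h]
  refine Finset.sum_congr rfl fun p _ => ?_
  simp [PowerSeries.evalNegHom, PowerSeries.coeff_rescale, PowerSeries.coeff_exp]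

/-- The identity `∑_{p,q} (1/p!) ((-1)^q/q!) F (p + q) = F 0`. -/
theorem finsum_exp_mul_exp_neg {F : ℕ → W} {N : ℕ} (hF : ∀ n, N ≤ n → F n = 0) :
    ∑ᶠ p : ℕ, ∑ᶠ q : ℕ, ((1 / (p.factorial : ℂ)) * ((-1) ^ q * (1 / (q.factorial : ℂ)))) •
      F (p + q) = F 0 := by
  have hf : (fun y : ℕ × ℕ => ((1 / (y.1.factorial : ℂ)) *
      ((-1) ^ y.2 * (1 / (y.2.factorial : ℂ)))) • F (y.1 + y.2)).HasFiniteSupport :=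
    hasFiniteSupport_prod (f := fun p q => ((1 / (p.factorial : ℂ)) *
      ((-1) ^ q * (1 / (q.factorial : ℂ)))) • F (p + q)) (Q := N)
      (fun p q hq => by rw [hF _ (by omega), smul_zero])
      fun q => ⟨N, fun p hp => by rw [hF _ (by omega), smul_zero]⟩
  rw [← finsum_sum_antidiagonal hf]
  have h1 : ∀ n : ℕ, ∑ p ∈ Finset.HasAntidiagonal.antidiagonal n, ((1 / (p.1.factorial : ℂ)) *
      ((-1) ^ p.2 * (1 / (p.2.factorial : ℂ)))) • F (p.1 + p.2) =
      (if n = 0 then (1 : ℂ) else 0) • F n := fun n => by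
    rw [← sum_antidiagonal_exp, Finset.sum_smul]
    exact Finset.sum_congr rfl fun p hp => by rw [Finset.HasAntidiagonal.mem_antidiagonal.1 hp]
  rw [finsum_congr h1, finsum_eq_single _ 0 fun n hn => by simp [hn]]
  simp

theorem locExp_one_locExp_neg_one (L : End ℂ W) (hL : IsLocallyFinite fun k => L ^ k) (w : W) :
    locExp L hL 1 (locExp L hL (-1) w) = w := by
  obtain ⟨N, hN⟩ := hL w
  rw [locExp_apply L hL 1]
  refine Eq.trans (finsum_congr fun p => ?_)
    ((finsum_exp_mul_exp_neg (F := fun n => (L ^ n) w) hN).trans (by simp))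
  rw [locExp_apply, map_finsum _
    (hasFiniteSupport_of_forall_ge (N := N) fun n hn => by simp [hN n hn]), smul_finsum]
  refine finsum_congr fun q => ?_
  rw [map_smul, smul_smul, ← Module.End.mul_apply, ← pow_add]
  simp

theorem neg_pow_apply (L : End ℂ W) (k : ℕ) (w : W) :
    ((-L) ^ k) w = (-1 : ℂ) ^ k • (L ^ k) w := by
  rw [← neg_one_smul ℂ L, smul_pow, LinearMap.smul_apply]

theorem locExp_neg_one_locExp_one (L : End ℂ W) (hL : IsLocallyFinite fun k => L ^ k) (w : W) :
    locExp L hL (-1) (locExp L hL 1 w) = w := by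
  have hL' : IsLocallyFinite fun k => (-L) ^ k := fun w => by
    obtain ⟨N, hN⟩ := hL w
    exact ⟨N, fun n hn => by simp only [neg_pow_apply, hN n hn, smul_zero]⟩
  have h : ∀ (x : ℂ) (w : W), locExp (-L) hL' x w = locExp L hL (-x) w := fun x w => by
    rw [locExp_apply, locExp_apply]
    refine finsum_congr fun k => ?_
    rw [neg_pow_apply, smul_smul, neg_pow x]
    ring_nf
  have h1 := locExp_one_locExp_neg_one (-L) hL' w
  rwa [h, h, neg_neg] at h1

end LocallyFinite

/-! ### Commutator formulas from the Jacobi identity -/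

/-- The case l = 0: the binomials `Ring.choose 0 i` leave only i = 0 in both sums on the left. -/
theorem JacobiIdentity.commutator {A W₁ W₂ W₃ : Type*} [AddCommGroupWithOne A]
    [AddCommGroup W₁] [Module ℂ W₁] [AddCommGroup W₂] [Module ℂ W₂]
    [AddCommGroup W₃] [Module ℂ W₃]
    {a₁ : ℤ → End ℂ W₁} {a₂ : ℤ → End ℂ W₂} {a₃ : ℤ → End ℂ W₃}
    {I : W₁ → A → W₂ →ₗ[ℂ] W₃} (h : JacobiIdentity a₁ a₂ a₃ I)
    (w₁ : W₁) (w₂ : W₂) (m : ℤ) (n : A) :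
    a₃ m (I w₁ n w₂) - I w₁ n (a₂ m w₂) =
      ∑ᶠ i : ℕ, ((Ring.choose m i : ℤ) : ℂ) • I (a₁ i w₁) ((m : A) + n - (i : A)) w₂ := by
  have h0 := h w₁ w₂ 0 m n
  rw [finsum_eq_single _ 0, finsum_eq_single _ 0] at h0
  · simpa using h0
  · intro i hi
    simp [Ring.choose_zero_pos ℤ (Nat.pos_of_ne_zero hi)]
  · intro i hi
    simp [Ring.choose_zero_pos ℤ (Nat.pos_of_ne_zero hi)]

theorem choose_natCast_eq_zero {m : ℕ} {i : ℕ} (h : m < i) : Ring.choose (m : ℤ) i = 0 := by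
  rw [Ring.choose_natCast, Nat.choose_eq_zero_of_lt h, Nat.cast_zero]

theorem JacobiIdentity.commutator_one {A W₁ W₂ W₃ : Type*} [AddCommGroupWithOne A]
    [AddCommGroup W₁] [Module ℂ W₁] [AddCommGroup W₂] [Module ℂ W₂]
    [AddCommGroup W₃] [Module ℂ W₃]
    {a₁ : ℤ → End ℂ W₁} {a₂ : ℤ → End ℂ W₂} {a₃ : ℤ → End ℂ W₃}
    {I : W₁ → A → W₂ →ₗ[ℂ] W₃} (h : JacobiIdentity a₁ a₂ a₃ I)
    (w₁ : W₁) (w₂ : W₂) (n : A) :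
    a₃ 1 (I w₁ n w₂) - I w₁ n (a₂ 1 w₂) = I (a₁ 0 w₁) (n + 1) w₂ + I (a₁ 1 w₁) n w₂ := by
  rw [h.commutator, finsum_eq_sum_range (N := 2) fun i hi => by
    rw [← Nat.cast_one, choose_natCast_eq_zero (by omega)]; simp]
  simp [Finset.sum_range_succ, add_comm (1 : A)]

theorem JacobiIdentity.commutator_two {A W₁ W₂ W₃ : Type*} [AddCommGroupWithOne A]
    [AddCommGroup W₁] [Module ℂ W₁] [AddCommGroup W₂] [Module ℂ W₂]
    [AddCommGroup W₃] [Module ℂ W₃]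
    {a₁ : ℤ → End ℂ W₁} {a₂ : ℤ → End ℂ W₂} {a₃ : ℤ → End ℂ W₃}
    {I : W₁ → A → W₂ →ₗ[ℂ] W₃} (h : JacobiIdentity a₁ a₂ a₃ I)
    (w₁ : W₁) (w₂ : W₂) (n : A) :
    a₃ 2 (I w₁ n w₂) - I w₁ n (a₂ 2 w₂) =
      I (a₁ 0 w₁) (n + 2) w₂ + (2 : ℂ) • I (a₁ 1 w₁) (n + 1) w₂ + I (a₁ 2 w₁) n w₂ := by
  have h2 : Ring.choose (2 : ℤ) 2 = 1 := by
    rw [← Nat.cast_two, Ring.choose_natCast]; rfl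
  rw [h.commutator, finsum_eq_sum_range (N := 3) fun i hi => by
    rw [← Nat.cast_two, choose_natCast_eq_zero (by omega)]; simp]
  have e1 : n + 2 - 1 = n + 1 := by
    rw [add_sub_assoc, ← one_add_one_eq_two, add_sub_cancel_right]
  simp [Finset.sum_range_succ, h2, e1, add_comm (2 : A)]

/-! ### Module modes, L(-1), L(0), L(1) and the grading -/

namespace VOAModule

variable {V : Type*} [AddCommGroup V] [Module ℂ V] {𝒱 : VertexOperatorAlgebra V}
variable {W : Type*} [AddCommGroup W] [Module ℂ W] (M : VOAModule 𝒱 W)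

theorem mode_add (v v' : V) (n : ℤ) : M.mode (v + v') n = M.mode v n + M.mode v' n := by
  simp [mode]

theorem mode_smul (c : ℂ) (v : V) (n : ℤ) : M.mode (c • v) n = c • M.mode v n := by
  simp [mode]

theorem mode_zero (n : ℤ) : M.mode 0 n = 0 := by
  simp [mode]

theorem exists_forall_mode_eq_zero (v : V) (w : W) : ∃ N : ℤ, ∀ n, N ≤ n → M.mode v n w = 0 :=
  ⟨-HahnSeries.order ((HahnModule.of ℂ).symm (M.Y v w)), fun n hn =>
    VertexOperator.ncoeff_eq_zero_of_lt_order _ _ _ (by omega)⟩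

theorem isLocallyFinite_mode (v : V) (l : ℤ) : IsLocallyFinite fun i : ℕ => M.mode v (l + i) := by
  intro w
  obtain ⟨N, hN⟩ := M.exists_forall_mode_eq_zero v w
  exact ⟨(N - l).toNat, fun i hi => hN _ (by omega)⟩

theorem jacobi_mode (u : V) : JacobiIdentity (𝒱.adjoint.mode u) (M.mode u) (M.mode u)
    (fun v => M.mode v) := M.jacobi u

theorem L_neg_one_eq (v : V) : 𝒱.adjoint.L (-1) v = 𝒱.adjoint.mode v (-2) 𝒱.vac := by
  have h := LinearMap.congr_fun (𝒱.deriv v (-1)) 𝒱.vac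
  rw [𝒱.creation] at h
  simpa [L, mode, VertexOperatorAlgebra.adjoint] using h

theorem neg_one_pow_mul_choose_neg_two (i : ℕ) :
    (-1 : ℂ) ^ i * ((Ring.choose (-2 : ℤ) i : ℤ) : ℂ) = i + 1 := by
  have h := Ring.choose_neg (2 : ℤ) i
  have h2 : (2 : ℤ) + i - 1 = ((i + 1 : ℕ) : ℤ) := by push_cast; ring
  rw [h2, Ring.choose_natCast, Nat.choose_succ_self_right] at h
  rw [h, Int.negOnePow_def]
  push_cast
  simp only [Units.smul_def, smul_eq_mul]
  have h3 : (((((-1 : ℤˣ) ^ (i : ℤ) : ℤˣ) : ℤ)) : ℂ) = (-1) ^ i := by simp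
  push_cast at h3 ⊢
  rw [← mul_assoc, h3, ← mul_pow]
  norm_num

/-- The `L(-1)`-derivative property on a module. -/
theorem mode_L_neg_one (v : V) (n : ℤ) :
    M.mode (𝒱.adjoint.L (-1) v) n = (-(n : ℂ)) • M.mode v (n - 1) := by
  ext w
  have hv : ∀ (k : ℤ) (w : W), M.mode 𝒱.vac k w = if k = -1 then w else 0 := M.vacuum
  -- In the Jacobi identity with 𝟏 in the second slot, l = -2 and m = 0, the right side is the mode
  -- of v_{-2} 𝟏 = L(-1) v. Only one mode of 𝟏 is nonzero, so each left sum has at most one term: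
  -- the first survives for n < 0, the second for n > 0.
  have h := M.jacobi_mode v 𝒱.vac w (-2) 0 n
  rw [finsum_eq_single (fun i : ℕ => ((Ring.choose (0 : ℤ) i : ℤ) : ℂ) • _) 0
    fun i hi => by simp [Ring.choose_zero_pos ℤ (Nat.pos_of_ne_zero hi)]] at h
  simp only [neg_one_pow_mul_choose_neg_two, hv] at h
  rw [L_neg_one_eq]
  simp only [Ring.choose_zero_right, Int.cast_one, one_smul, Nat.cast_zero, add_zero, sub_zero,
    Int.cast_zero, zero_add, Int.cast_id, LinearMap.smul_apply] at h ⊢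
  rw [← h]
  rcases lt_trichotomy n 0 with hn | hn | hn
  · rw [finsum_eq_single _ (-1 - n).toNat, finsum_eq_zero_of_forall_eq_zero]
    · have h1 : (((-1 - n).toNat : ℕ) : ℤ) = -1 - n := by omega
      have h2 : (((-1 - n).toNat : ℕ) : ℂ) = -1 - n := by
        exact_mod_cast congr_arg (Int.cast : ℤ → ℂ) h1
      rw [h2, h1, if_pos (by omega)]
      simp only [smul_zero, sub_zero]
      congr 2
      · ring
      · congr 1; ring
    · intro i
      rw [if_neg (by omega), smul_zero]
    · intro i hi
      rw [if_neg (by omega), map_zero, smul_zero]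
  · subst hn
    rw [finsum_eq_zero_of_forall_eq_zero, finsum_eq_zero_of_forall_eq_zero]
    · simp
    · intro i
      rw [if_neg (by omega), smul_zero]
    · intro i
      rw [if_neg (by omega), map_zero, smul_zero]
  · rw [finsum_eq_zero_of_forall_eq_zero, finsum_eq_single _ (n - 1).toNat]
    · have h1 : (((n - 1).toNat : ℕ) : ℤ) = n - 1 := by omega
      have h2 : (((n - 1).toNat : ℕ) : ℂ) = n - 1 := by
        exact_mod_cast congr_arg (Int.cast : ℤ → ℂ) h1
      rw [h2, h1, if_pos (by omega)]
      simp
    · intro i hi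
      rw [if_neg (by omega), smul_zero]
    · intro i
      rw [if_neg (by omega), map_zero, smul_zero]

theorem mem_wtSpace_iff {h : ℂ} {w : W} : w ∈ M.wtSpace h ↔ M.L 0 w = h • w :=
  End.mem_eigenspace_iff

theorem L_zero_comp_mode (v : V) (n : ℤ) (w : W) :
    M.L 0 (M.mode v n w) - M.mode v n (M.L 0 w) =
      M.mode (𝒱.adjoint.L 0 v) n w - ((n : ℂ) + 1) • M.mode v n w := by
  have h := (M.jacobi_mode 𝒱.conf).commutator_one v w n
  have h1 := LinearMap.congr_fun (M.mode_L_neg_one v (n + 1)) w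
  rw [LinearMap.smul_apply, add_sub_cancel_right] at h1
  refine h.trans ?_
  refine (congr_arg₂ (· + ·) h1 rfl).trans ?_
  push_cast
  rw [neg_smul, neg_add_eq_sub]
  rfl

theorem L_one_comp_mode (v : V) (n : ℤ) :
    M.L 1 * M.mode v n - M.mode v n * M.L 1 =
      M.mode (𝒱.adjoint.L 1 v) n + (2 : ℂ) • M.mode (𝒱.adjoint.L 0 v) (n + 1)
        - ((n : ℂ) + 2) • M.mode v (n + 1) := by
  ext w
  have h := (M.jacobi_mode 𝒱.conf).commutator_two v w n
  have h1 := LinearMap.congr_fun (M.mode_L_neg_one v (n + 2)) w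
  rw [LinearMap.smul_apply, show n + 2 - 1 = n + 1 by ring] at h1
  refine h.trans ?_
  refine (congr_arg₂ (· + ·) (congr_arg₂ (· + ·) h1 rfl) rfl).trans ?_
  push_cast
  simp only [LinearMap.sub_apply, LinearMap.add_apply, LinearMap.smul_apply]
  rw [neg_smul]
  have e : 𝒱.adjoint.L 1 v = 𝒱.adjoint.mode 𝒱.conf 2 v := rfl
  have e' : 𝒱.adjoint.L 0 v = 𝒱.adjoint.mode 𝒱.conf 1 v := rfl
  rw [e, e']
  abel

theorem mode_mem_wtSpace {v : V} {j : ℂ} (hv : v ∈ 𝒱.adjoint.wtSpace j) {w : W} {h : ℂ}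
    (hw : w ∈ M.wtSpace h) (n : ℤ) : M.mode v n w ∈ M.wtSpace (h + j - n - 1) := by
  rw [mem_wtSpace_iff] at *
  have h0 := M.L_zero_comp_mode v n w
  rw [hv, hw, mode_smul, map_smul, LinearMap.smul_apply, sub_eq_iff_eq_add] at h0
  rw [h0]
  module

theorem L_one_comp_mode_of_mem {v : V} {j : ℂ} (hv : v ∈ 𝒱.adjoint.wtSpace j) (n : ℤ) :
    M.L 1 * M.mode v n - M.mode v n * M.L 1 =
      (2 * j - 2 - n) • M.mode v (n + 1) + M.mode (𝒱.adjoint.L 1 v) n := by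
  rw [mem_wtSpace_iff] at hv
  rw [L_one_comp_mode, hv, mode_smul]
  module

theorem conf_mem_wtSpace : 𝒱.conf ∈ 𝒱.adjoint.wtSpace 2 := 𝒱.conf_mem

theorem L_one_mem_wtSpace {w : W} {h : ℂ} (hw : w ∈ M.wtSpace h) :
    M.L 1 w ∈ M.wtSpace (h - 1) := by
  have : M.L 1 w ∈ _ := M.mode_mem_wtSpace conf_mem_wtSpace hw 2
  convert this using 2
  push_cast; ring

theorem L_one_pow_mem_wtSpace {w : W} {h : ℂ} (hw : w ∈ M.wtSpace h) (k : ℕ) :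
    (M.L 1 ^ k) w ∈ M.wtSpace (h - k) := by
  induction k with
  | zero => simpa using hw
  | succ k ih =>
    rw [pow_succ', Module.End.mul_apply]
    convert M.L_one_mem_wtSpace ih using 2
    push_cast; ring

theorem iSup_wtSpace : ⨆ h, M.wtSpace h = ⊤ := M.graded.submodule_iSup_eq_top

theorem wt_induction {p : W → Prop} (hom : ∀ h, ∀ w ∈ M.wtSpace h, p w)
    (add : ∀ w w', p w → p w' → p (w + w')) (w : W) : p w :=
  Submodule.iSup_induction M.wtSpace (motive := p) (M.iSup_wtSpace ▸ Submodule.mem_top) hom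
    (hom 0 0 (zero_mem _)) add

theorem int_wt_induction (𝒱 : VertexOperatorAlgebra V) {p : V → Prop}
    (hom : ∀ j : ℤ, ∀ v ∈ 𝒱.adjoint.wtSpace (j : ℂ), p v)
    (add : ∀ v v', p v → p v' → p (v + v')) (v : V) : p v :=
  Submodule.iSup_induction (fun j : ℤ => 𝒱.adjoint.wtSpace (j : ℂ)) (motive := p)
    ((𝒱.graded.submodule_iSup_eq_top : ⨆ j : ℤ, 𝒱.adjoint.wtSpace (j : ℂ) = ⊤) ▸
      Submodule.mem_top) hom (hom 0 0 (zero_mem _)) add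

/-- L(1) lowers the weight by 1, and the real parts of the weights are bounded below. -/
theorem isLocallyFinite_L_one_pow : IsLocallyFinite fun k => M.L 1 ^ k := by
  intro w
  induction w using M.wt_induction with
  | hom h w hw =>
    obtain ⟨N, hN⟩ := M.bounded_below
    obtain ⟨K, hK⟩ := exists_nat_gt (h.re - N)
    refine ⟨K, fun k hk => ?_⟩
    have hmem := M.L_one_pow_mem_wtSpace hw k
    have hkK : (K : ℝ) ≤ k := by exact_mod_cast hk
    have hbot : M.wtSpace (h - k) = ⊥ := hN _ (by simp; linarith)
    rw [hbot] at hmem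
    exact (Submodule.mem_bot ℂ).1 hmem
  | add w w' h h' =>
    obtain ⟨N, hN⟩ := h
    obtain ⟨N', hN'⟩ := h'
    refine ⟨max N N', fun k hk => ?_⟩
    rw [map_add, hN k (le_trans (le_max_left _ _) hk), hN' k (le_trans (le_max_right _ _) hk),
      add_zero]

theorem wtProj_of_mem {h : ℂ} {w : W} (hw : w ∈ M.wtSpace h) : M.wtProj h w = w := by
  have : (LinearEquiv.ofBijective (DirectSum.coeLinearMap fun k => M.wtSpace k) M.graded).symm w =
      DirectSum.lof ℂ ℂ (fun k => M.wtSpace k) h ⟨w, hw⟩ := by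
    rw [LinearEquiv.symm_apply_eq]
    exact (DirectSum.coeLinearMap_lof (fun k => M.wtSpace k) h ⟨w, hw⟩).symm
  simp [wtProj, this, DirectSum.component.lof_self]

theorem wtProj_of_mem_ne {h h' : ℂ} {w : W} (hw : w ∈ M.wtSpace h) (hne : h' ≠ h) :
    M.wtProj h' w = 0 := by
  have : (LinearEquiv.ofBijective (DirectSum.coeLinearMap fun k => M.wtSpace k) M.graded).symm w =
      DirectSum.lof ℂ ℂ (fun k => M.wtSpace k) h ⟨w, hw⟩ := by
    rw [LinearEquiv.symm_apply_eq]
    exact (DirectSum.coeLinearMap_lof (fun k => M.wtSpace k) h ⟨w, hw⟩).symm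
  simp only [wtProj, LinearMap.comp_apply, LinearEquiv.coe_coe, this]
  rw [DirectSum.component.of, dif_neg hne.symm, map_zero]

theorem hasFiniteSupport_wtProj (w : W) : (fun h => M.wtProj h w).HasFiniteSupport := by
  induction w using M.wt_induction with
  | hom h w hw =>
    refine (Set.finite_singleton h).subset fun h' hh' => ?_
    by_contra hne
    exact hh' (M.wtProj_of_mem_ne hw hne)
  | add w w' h h' =>
    simp only [map_add]
    exact h.add h'

end VOAModule

/-! ### Opposite modes and conjugation by e^{L(1)} -/

theorem succ_mul_choose_succ (r : ℤ) (i : ℕ) :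
    ((i : ℂ) + 1) * ((Ring.choose r (i + 1) : ℤ) : ℂ) =
      ((r : ℂ) - i) * ((Ring.choose r i : ℤ) : ℂ) := by
  have h := Ring.choose_smul_choose r (Nat.le_succ i)
  rw [Nat.succ_eq_add_one, Nat.choose_succ_self_right, Nat.add_sub_cancel_left,
    Ring.choose_one_right, nsmul_eq_mul, mul_comm (Ring.choose r i)] at h
  exact_mod_cast congr_arg (Int.cast : ℤ → ℂ) h

theorem choose_add_one_succ (r : ℤ) (i : ℕ) :
    ((Ring.choose (r + 1) (i + 1) : ℤ) : ℂ) =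
      ((Ring.choose r i : ℤ) : ℂ) + ((Ring.choose r (i + 1) : ℤ) : ℂ) := by
  rw [Ring.choose_succ_succ]
  push_cast
  rfl

namespace VOAModule

variable {V : Type*} [AddCommGroup V] [Module ℂ V] {𝒱 : VertexOperatorAlgebra V}
variable {W : Type*} [AddCommGroup W] [Module ℂ W] (M : VOAModule 𝒱 W)

/-- The operator `∑_k (1/k!) (L(1)^k v)_{2j-k-n-2}`, which for `v` of weight `j` is
`(-1)^j v^o_n`. -/
def oppSum (j : ℤ) (v : V) (n : ℤ) : End ℂ W :=
  ∑ᶠ k : ℕ, (1 / (k.factorial : ℂ)) • M.mode ((𝒱.adjoint.L 1 ^ k) v) (2 * j - k - n - 2)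

theorem oppSum_eq_sum {v : V} {S : ℕ} (hS : ∀ k, S ≤ k → (𝒱.adjoint.L 1 ^ k) v = 0) (j n : ℤ) :
    M.oppSum j v n = ∑ k ∈ Finset.range S,
      (1 / (k.factorial : ℂ)) • M.mode ((𝒱.adjoint.L 1 ^ k) v) (2 * j - k - n - 2) :=
  finsum_eq_sum_range fun k hk => by rw [hS k hk, mode_zero, smul_zero]

theorem oppSum_add (j : ℤ) (v v' : V) (n : ℤ) :
    M.oppSum j (v + v') n = M.oppSum j v n + M.oppSum j v' n := by
  have hfin : ∀ v : V, (fun k : ℕ => (1 / (k.factorial : ℂ)) •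
      M.mode ((𝒱.adjoint.L 1 ^ k) v) (2 * j - k - n - 2)).HasFiniteSupport := fun v => by
    obtain ⟨S, hS⟩ := 𝒱.adjoint.isLocallyFinite_L_one_pow v
    exact hasFiniteSupport_of_forall_ge (N := S) fun k hk => by rw [hS k hk, mode_zero, smul_zero]
  rw [oppSum, oppSum, oppSum, ← finsum_add_distrib (hfin v) (hfin v')]
  simp only [map_add, mode_add, smul_add]

theorem oppSum_zero (j n : ℤ) : M.oppSum j 0 n = 0 := by
  simp [oppSum, mode_zero]

theorem oppMode_eq (v : V) (n : ℤ) :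
    M.oppMode v n = ∑ᶠ j : ℤ, (-1 : ℂ) ^ j • M.oppSum j (𝒱.adjoint.wtProj (j : ℂ) v) n := rfl

theorem oppMode_of_mem {v : V} {j : ℤ} (hv : v ∈ 𝒱.adjoint.wtSpace (j : ℂ)) (n : ℤ) :
    M.oppMode v n = (-1 : ℂ) ^ j • M.oppSum j v n := by
  rw [oppMode_eq, finsum_eq_single _ j, 𝒱.adjoint.wtProj_of_mem hv]
  intro i hi
  rw [𝒱.adjoint.wtProj_of_mem_ne hv (by exact_mod_cast hi), oppSum_zero, smul_zero]

theorem oppMode_add (v v' : V) (n : ℤ) :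
    M.oppMode (v + v') n = M.oppMode v n + M.oppMode v' n := by
  have hfin : ∀ v : V, (fun j : ℤ => (-1 : ℂ) ^ j •
      M.oppSum j (𝒱.adjoint.wtProj (j : ℂ) v) n).HasFiniteSupport := fun v => by
    refine (((𝒱.adjoint.hasFiniteSupport_wtProj v).preimage
      (f := fun j : ℤ => (j : ℂ)) Int.cast_injective.injOn)).subset fun j hj => ?_
    intro h0
    refine hj ?_
    have h1 : 𝒱.adjoint.wtProj (j : ℂ) v = 0 := h0
    simp only [h1, oppSum_zero, smul_zero]
  rw [oppMode_eq, oppMode_eq, oppMode_eq, ← finsum_add_distrib (hfin v) (hfin v')]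
  simp only [map_add, oppSum_add, smul_add]

/-- Since ω = L(-2) 𝟏 and both L(1) and L(-1) kill 𝟏, this follows from [L(1), L(-2)] = 3 L(-1),
where no central term occurs. -/
theorem L_one_conf : 𝒱.adjoint.L 1 𝒱.conf = 0 := by
  have h := 𝒱.virasoro 1 (-2) 𝒱.vac
  have h1 : VertexOperator.ncoeff (𝒱.Y 𝒱.conf) (1 + 1) 𝒱.vac = 0 :=
    𝒱.creation_nonneg _ _ (by norm_num)
  have h2 : VertexOperator.ncoeff (𝒱.Y 𝒱.conf) (1 + -2 + 1) 𝒱.vac = 0 :=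
    𝒱.creation_nonneg _ _ (by norm_num)
  have h3 : VertexOperator.ncoeff (𝒱.Y 𝒱.conf) (-2 + 1) 𝒱.vac = 𝒱.conf := 𝒱.creation _
  rw [h1, h2, h3, map_zero] at h
  have h4 : VertexOperator.ncoeff (𝒱.Y 𝒱.conf) 2 𝒱.conf = 0 := by simpa using h
  exact h4

theorem oppSum_conf_one : M.oppSum 2 𝒱.conf 1 = M.L 0 := by
  rw [oppSum_eq_sum M (S := 1)]
  · simp [L]
  · intro k hk
    obtain ⟨k, rfl⟩ := Nat.exists_eq_add_of_le' hk
    rw [pow_succ, Module.End.mul_apply, L_one_conf, map_zero]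

/-- Thus L(0) is self-adjoint for every invariant pairing, which makes different weights orthogonal.
-/
theorem oppMode_conf_one : M.oppMode 𝒱.conf 1 = M.L 0 := by
  rw [M.oppMode_of_mem (j := 2) (by exact_mod_cast conf_mem_wtSpace), oppSum_conf_one]
  simp

theorem L_one_pow_mem_wtSpace_int {v : V} {j : ℤ} (hv : v ∈ 𝒱.adjoint.wtSpace (j : ℂ)) (k : ℕ) :
    (𝒱.adjoint.L 1 ^ k) v ∈ 𝒱.adjoint.wtSpace ((j - k : ℤ) : ℂ) := by
  have := 𝒱.adjoint.L_one_pow_mem_wtSpace hv k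
  push_cast
  exact this

theorem oppSum_mem_wtSpace {v : V} {j : ℤ} (hv : v ∈ 𝒱.adjoint.wtSpace (j : ℂ)) {w : W} {h : ℂ}
    (hw : w ∈ M.wtSpace h) (n : ℤ) : M.oppSum j v n w ∈ M.wtSpace (h - j + n + 1) := by
  obtain ⟨S, hS⟩ := 𝒱.adjoint.isLocallyFinite_L_one_pow v
  rw [M.oppSum_eq_sum hS, LinearMap.sum_apply]
  refine sum_mem fun k _ => ?_
  rw [LinearMap.smul_apply]
  refine Submodule.smul_mem _ _ ?_
  convert M.mode_mem_wtSpace (L_one_pow_mem_wtSpace_int hv k) hw (2 * j - k - n - 2) using 2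
  push_cast
  ring

/-- On the opposite operator L(1) acts as -d/dx, just as L(-1) acts as d/dx on the ordinary one.
Iterating yields the binomials of `expL_neg_oppSum`. -/
theorem L_one_comp_oppSum {v : V} {j : ℤ} (hv : v ∈ 𝒱.adjoint.wtSpace (j : ℂ)) (n : ℤ) :
    M.L 1 * M.oppSum j v n - M.oppSum j v n * M.L 1 = (n : ℂ) • M.oppSum j v (n - 1) := by
  obtain ⟨S, hS⟩ := 𝒱.adjoint.isLocallyFinite_L_one_pow v
  set Z : ℕ → End ℂ W := fun k => M.mode ((𝒱.adjoint.L 1 ^ k) v) (2 * j - k - n - 1) with hZ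
  have hZS : Z S = 0 := by rw [hZ]; dsimp only; rw [hS S le_rfl, mode_zero]
  have h1 : ∀ k : ℕ, M.L 1 * M.mode ((𝒱.adjoint.L 1 ^ k) v) (2 * j - k - n - 2) -
      M.mode ((𝒱.adjoint.L 1 ^ k) v) (2 * j - k - n - 2) * M.L 1 =
      ((n : ℂ) - k) • Z k + Z (k + 1) := fun k => by
    rw [M.L_one_comp_mode_of_mem (L_one_pow_mem_wtSpace_int hv k), hZ]
    dsimp only
    congr 2
    · push_cast; ring
    · congr 1; ring
    · rw [pow_succ', Module.End.mul_apply]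
    · push_cast; ring
  have h2 : M.oppSum j v (n - 1) = ∑ k ∈ Finset.range S, (1 / (k.factorial : ℂ)) • Z k := by
    rw [M.oppSum_eq_sum hS]
    refine Finset.sum_congr rfl fun k _ => ?_
    rw [hZ]
    dsimp only
    congr 2; ring
  -- Index shift without boundary terms: the k = 0 term carries the factor k, and Z S = 0. Its
  -- factor k cancels the -k in `h1`.
  have h3 : ∑ k ∈ Finset.range S, (1 / (k.factorial : ℂ)) • Z (k + 1) =
      ∑ k ∈ Finset.range S, ((k : ℂ) * (1 / (k.factorial : ℂ))) • Z k := by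
    have e := (Finset.sum_range_succ
      (fun k : ℕ => ((k : ℂ) * (1 / (k.factorial : ℂ))) • Z k) S).symm.trans
      (Finset.sum_range_succ' _ S)
    rw [hZS, smul_zero, add_zero, Nat.cast_zero, zero_mul, zero_smul, add_zero] at e
    rw [e]
    refine Finset.sum_congr rfl fun k _ => ?_
    congr 1
    have := Nat.cast_add_one_ne_zero (R := ℂ) k
    have hf0 : (k.factorial : ℂ) ≠ 0 := by exact_mod_cast k.factorial_ne_zero
    rw [Nat.factorial_succ]
    push_cast
    field_simp
  rw [M.oppSum_eq_sum hS, h2, Finset.mul_sum, Finset.sum_mul, ← Finset.sum_sub_distrib,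
    Finset.smul_sum]
  simp only [mul_smul_comm, smul_mul_assoc, ← smul_sub, h1, smul_add, Finset.sum_add_distrib]
  rw [h3, ← Finset.sum_add_distrib]
  refine Finset.sum_congr rfl fun k _ => ?_
  module

theorem isLocallyFinite_oppSum (j : ℤ) (v : V) (n : ℤ) :
    IsLocallyFinite fun a : ℕ => M.oppSum j v (n - a) := by
  intro w
  obtain ⟨S, hS⟩ := 𝒱.adjoint.isLocallyFinite_L_one_pow v
  choose N hN using fun k : ℕ => M.exists_forall_mode_eq_zero ((𝒱.adjoint.L 1 ^ k) v) w
  refine ⟨∑ k ∈ Finset.range S, (N k - (2 * j - k - n - 2)).toNat, fun a ha => ?_⟩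
  dsimp only
  rw [M.oppSum_eq_sum hS, LinearMap.sum_apply]
  refine Finset.sum_eq_zero fun k hk => ?_
  have hle := (Finset.single_le_sum
    (f := fun k : ℕ => (N k - (2 * j - k - n - 2)).toNat) (fun _ _ => Nat.zero_le _) hk).trans ha
  rw [LinearMap.smul_apply, hN k _ (by omega), smul_zero]

theorem isLocallyFinite_choose_oppSum (j : ℤ) (v : V) (n : ℤ) :
    IsLocallyFinite fun a : ℕ => ((Ring.choose n a : ℤ) : ℂ) • M.oppSum j v (n - a) :=
  (M.isLocallyFinite_oppSum j v n).smul _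

/-- The homogeneous components of `e^{L(1)} v_l e^{-L(1)}`, for `v` of weight `j`. -/
def conjMode (j : ℤ) (v : V) (l : ℤ) (k : ℕ) : End ℂ W :=
  ∑ p ∈ Finset.HasAntidiagonal.antidiagonal k,
    ((1 / (p.2.factorial : ℂ)) * ((Ring.choose (2 * j - 2 - l - p.2) p.1 : ℤ) : ℂ)) •
      M.mode ((𝒱.adjoint.L 1 ^ p.2) v) (l + p.1)

theorem conjMode_zero (j : ℤ) (v : V) (l : ℤ) : M.conjMode j v l 0 = M.mode v l := by
  simp [conjMode]

/-- Since L(1)^s v has weight j - s, bracketing its mode l + i with L(1) yields the pairs (i + 1,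
s), with coefficient 2j - 2 - l - 2s - i, and (i, s + 1), with coefficient 1. The binomial
coefficients of `conjMode` solve the resulting recursion. -/
theorem conjMode_succ {v : V} {j : ℤ} (hv : v ∈ 𝒱.adjoint.wtSpace (j : ℂ)) (l : ℤ) (k : ℕ) :
    ((k : ℂ) + 1) • M.conjMode j v l (k + 1) =
      M.L 1 * M.conjMode j v l k - M.conjMode j v l k * M.L 1 := by
  set m := 2 * j - 2 - l with hm
  set X : ℕ → ℕ → End ℂ W := fun i s => M.mode ((𝒱.adjoint.L 1 ^ s) v) (l + i) with hX
  set c : ℕ → ℕ → ℂ := fun i s =>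
    (1 / (s.factorial : ℂ)) * ((Ring.choose (m - s) i : ℤ) : ℂ) with hc
  -- Of the total (i + s) c i s, the share β arrives from (i, s - 1) and the rest α from (i - 1, s).
  set β : ℕ → ℕ → ℂ := fun i s =>
    s * ((1 / (s.factorial : ℂ)) * ((Ring.choose (m - s + 1) i : ℤ) : ℂ)) with hβ
  set α : ℕ → ℕ → ℂ := fun i s => ((i : ℂ) + s) * c i s - β i s with hα
  have hcX : ∀ k, M.conjMode j v l k =
      ∑ p ∈ Finset.HasAntidiagonal.antidiagonal k, c p.1 p.2 • X p.1 p.2 := fun k => rfl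
  have hcomm : ∀ i s, M.L 1 * X i s - X i s * M.L 1 =
      ((m : ℂ) - 2 * s - i) • X (i + 1) s + X i (s + 1) := fun i s => by
    rw [hX]
    dsimp only
    rw [M.L_one_comp_mode_of_mem (L_one_pow_mem_wtSpace_int hv s), pow_succ', Module.End.mul_apply]
    congr 2
    · rw [hm]; push_cast; ring
    · congr 1; push_cast; ring
  have hβ0 : ∀ i, β i 0 = 0 := fun i => by simp [hβ]
  have hβs : ∀ i s, β i (s + 1) = c i s := fun i s => by
    have h1 := Nat.cast_add_one_ne_zero (R := ℂ) s
    have hf0 : (s.factorial : ℂ) ≠ 0 := by exact_mod_cast s.factorial_ne_zero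
    simp only [hβ, hc]
    rw [Nat.factorial_succ, show m - ((s + 1 : ℕ) : ℤ) + 1 = m - s by push_cast; ring]
    push_cast
    field_simp
  have hα0 : ∀ s, α 0 s = 0 := fun s => by simp [hα, hβ, hc]
  have hαs : ∀ i s, α (i + 1) s = c i s * ((m : ℂ) - 2 * s - i) := fun i s => by
    have h1 := succ_mul_choose_succ (m - s) i
    push_cast at h1
    simp only [hα, hβ, hc, choose_add_one_succ]
    push_cast
    linear_combination (1 / (s.factorial : ℂ)) * h1
  have hL : ((k : ℂ) + 1) • M.conjMode j v l (k + 1) =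
      ∑ p ∈ Finset.HasAntidiagonal.antidiagonal (k + 1), α p.1 p.2 • X p.1 p.2 +
      ∑ p ∈ Finset.HasAntidiagonal.antidiagonal (k + 1), β p.1 p.2 • X p.1 p.2 := by
    rw [hcX, Finset.smul_sum, ← Finset.sum_add_distrib]
    refine Finset.sum_congr rfl fun p hp => ?_
    have : (k : ℂ) + 1 = p.1 + p.2 := by
      rw [Finset.HasAntidiagonal.mem_antidiagonal] at hp
      exact_mod_cast hp.symm
    rw [← add_smul, smul_smul, this]
    congr 1
    simp only [hα]
    ring
  rw [hL, Finset.Nat.sum_antidiagonal_succ, Finset.Nat.sum_antidiagonal_succ' (n := k), hcX,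
    Finset.mul_sum, Finset.sum_mul, ← Finset.sum_sub_distrib]
  simp only [hα0, hβ0, hαs, hβs, zero_smul, zero_add, mul_smul_comm, smul_mul_assoc, ← smul_sub,
    hcomm, smul_add, Finset.sum_add_distrib, smul_smul]

theorem hasFiniteSupport_conjMode (j : ℤ) (v : V) (l : ℤ) (w : W) :
    (fun p : ℕ × ℕ =>
      ((1 / (p.2.factorial : ℂ)) * ((Ring.choose (2 * j - 2 - l - p.2) p.1 : ℤ) : ℂ)) •
        M.mode ((𝒱.adjoint.L 1 ^ p.2) v) (l + p.1) w).HasFiniteSupport := by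
  obtain ⟨S, hS⟩ := 𝒱.adjoint.isLocallyFinite_L_one_pow v
  refine hasFiniteSupport_prod (f := fun i s : ℕ =>
    ((1 / (s.factorial : ℂ)) * ((Ring.choose (2 * j - 2 - l - s) i : ℤ) : ℂ)) •
        M.mode ((𝒱.adjoint.L 1 ^ s) v) (l + i) w) (Q := S) (fun i s hs => ?_) fun s => ?_
  · rw [hS s hs, mode_zero, LinearMap.zero_apply, smul_zero]
  · obtain ⟨N, hN⟩ := M.isLocallyFinite_mode ((𝒱.adjoint.L 1 ^ s) v) l w
    exact ⟨N, fun i hi => by rw [hN i hi, smul_zero]⟩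

theorem conjMode_apply (j : ℤ) (v : V) (l : ℤ) (k : ℕ) (w : W) : M.conjMode j v l k w =
    ∑ p ∈ Finset.HasAntidiagonal.antidiagonal k,
      ((1 / (p.2.factorial : ℂ)) * ((Ring.choose (2 * j - 2 - l - p.2) p.1 : ℤ) : ℂ)) •
        M.mode ((𝒱.adjoint.L 1 ^ p.2) v) (l + p.1) w := by
  simp only [conjMode, LinearMap.sum_apply, LinearMap.smul_apply]

theorem isLocallyFinite_conjMode (j : ℤ) (v : V) (l : ℤ) : IsLocallyFinite (M.conjMode j v l) := by
  intro w
  have hfin : ((fun p : ℕ × ℕ => p.1 + p.2) '' _).Finite :=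
    Set.Finite.image _ (M.hasFiniteSupport_conjMode j v l w)
  obtain ⟨N, hN⟩ := hfin.bddAbove
  refine ⟨N + 1, fun k hk => ?_⟩
  rw [conjMode_apply]
  refine Finset.sum_eq_zero fun p hp => ?_
  by_contra h0
  have := hN ⟨p, h0, rfl⟩
  dsimp only at this
  rw [Finset.HasAntidiagonal.mem_antidiagonal.1 hp] at this
  omega

theorem locSum_conjMode {v : V} {S : ℕ} (hS : ∀ k, S ≤ k → (𝒱.adjoint.L 1 ^ k) v = 0)
    (j l : ℤ) (w : W) :
    locSum (M.conjMode j v l) (M.isLocallyFinite_conjMode j v l) w =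
      ∑ s ∈ Finset.range S, (1 / (s.factorial : ℂ)) • ∑ᶠ i : ℕ,
        ((Ring.choose (2 * j - 2 - l - s) i : ℤ) : ℂ) •
          M.mode ((𝒱.adjoint.L 1 ^ s) v) (l + i) w := by
  rw [locSum_apply, finsum_congr fun k => M.conjMode_apply j v l k w]
  rw [finsum_sum_antidiagonal (f := fun i s : ℕ => ((1 / (s.factorial : ℂ)) *
    ((Ring.choose (2 * j - 2 - l - s) i : ℤ) : ℂ)) • M.mode ((𝒱.adjoint.L 1 ^ s) v) (l + i) w)
    (M.hasFiniteSupport_conjMode j v l w)]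
  have h1 : ∀ i : ℕ, ∑ᶠ s : ℕ, ((1 / (s.factorial : ℂ)) *
      ((Ring.choose (2 * j - 2 - l - s) i : ℤ) : ℂ)) • M.mode ((𝒱.adjoint.L 1 ^ s) v) (l + i) w =
      ∑ s ∈ Finset.range S, ((1 / (s.factorial : ℂ)) *
      ((Ring.choose (2 * j - 2 - l - s) i : ℤ) : ℂ)) • M.mode ((𝒱.adjoint.L 1 ^ s) v) (l + i) w :=
    fun i => finsum_eq_sum_range fun s hs => by
      rw [hS s hs, mode_zero, LinearMap.zero_apply, smul_zero]
  rw [finsum_congr h1, finsum_sum_comm]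
  · simp only [mul_smul, smul_finsum]
  · intro s _
    obtain ⟨N, hN⟩ := M.isLocallyFinite_mode ((𝒱.adjoint.L 1 ^ s) v) l w
    exact hasFiniteSupport_of_forall_ge (N := N) fun i hi => by rw [hN i hi, smul_zero]

/-- The operator `e^{xL(1)}`. -/
def expL (x : ℂ) : End ℂ W := locExp (M.L 1) M.isLocallyFinite_L_one_pow x

theorem expL_mode {v : V} {j : ℤ} (hv : v ∈ 𝒱.adjoint.wtSpace (j : ℂ)) (l : ℤ) (w : W) :
    M.expL 1 (M.mode v l w) =
      locSum (M.conjMode j v l) (M.isLocallyFinite_conjMode j v l) (M.expL 1 w) := by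
  have h := locExp_comp M.isLocallyFinite_L_one_pow (M.conjMode_succ hv l)
    (M.isLocallyFinite_conjMode j v l) 1 w
  rw [conjMode_zero] at h
  refine h.trans ?_
  simp only [locSum_apply, one_pow, one_smul]
  rfl

theorem expL_neg_oppSum {v : V} {j : ℤ} (hv : v ∈ 𝒱.adjoint.wtSpace (j : ℂ)) (l : ℤ) (w : W) :
    M.expL (-1) (M.oppSum j v l w) =
      locSum (fun a : ℕ => (-1 : ℂ) ^ a • ((Ring.choose l a : ℤ) : ℂ) • M.oppSum j v (l - a))
        ((M.isLocallyFinite_choose_oppSum j v l).smul _) (M.expL (-1) w) := by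
  have h := locExp_comp (R := fun a : ℕ => ((Ring.choose l a : ℤ) : ℂ) • M.oppSum j v (l - a))
    M.isLocallyFinite_L_one_pow (fun k => ?_) (M.isLocallyFinite_choose_oppSum j v l) (-1) w
  · refine Eq.trans ?_ h
    simp only [Ring.choose_zero_right, Int.cast_one, one_smul, Nat.cast_zero, sub_zero]
    rfl
  · rw [mul_smul_comm, smul_mul_assoc, ← smul_sub, M.L_one_comp_oppSum hv, smul_smul, smul_smul,
      succ_mul_choose_succ]
    push_cast
    rw [mul_comm, sub_sub]

end VOAModule

/-! ### The vacuum functional and the pairing at x = 1 -/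

theorem sum_smul_map_finsum {E : Type*} [AddCommGroup E] [Module ℂ E] (f : E →ₗ[ℂ] ℂ) (S : ℕ)
    (a c : ℕ → ℂ) (F : ℕ → ℕ → E) (hF : ∀ s, (F s).HasFiniteSupport) :
    ∑ s ∈ Finset.range S, a s * f (∑ᶠ i, c i • F s i) =
      ∑ᶠ i, c i * f (∑ s ∈ Finset.range S, a s • F s i) := by
  have hcF : ∀ s, (fun i => c i • F s i).HasFiniteSupport := fun s =>
    (hF s).subset fun i hi h0 => hi (by simp [h0])
  have hfin : ∀ s, (fun i => c i * (a s * f (F s i))).HasFiniteSupport := fun s =>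
    (hF s).subset fun i hi h0 => hi (by simp [h0])
  simp only [map_sum, map_smul, smul_eq_mul, Finset.mul_sum]
  rw [finsum_sum_comm _ _ fun s _ => hfin s]
  refine Finset.sum_congr rfl fun s _ => ?_
  rw [map_finsum f (hcF s), mul_finsum]
  refine finsum_congr fun i => ?_
  rw [map_smul, smul_eq_mul]
  ring

/-- A linear functional on `V` that behaves like `(𝟏, ·)_V`: the functional `λ` with
`λ ∘ v^o_n = 0` for `n ≥ 0`. -/
def IsVacuumFunctional {V : Type*} [AddCommGroup V] [Module ℂ V] (𝒱 : VertexOperatorAlgebra V)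
    (lam : V →ₗ[ℂ] ℂ) : Prop :=
  ∀ (j : ℤ), ∀ v ∈ 𝒱.adjoint.wtSpace (j : ℂ), ∀ n : ℤ, 0 ≤ n → ∀ u,
    lam (𝒱.adjoint.oppSum j v n u) = 0

namespace IntertwiningOperator

variable {V W₁ W₂ W₃ : Type*} [AddCommGroup V] [Module ℂ V]
  [AddCommGroup W₁] [Module ℂ W₁] [AddCommGroup W₂] [Module ℂ W₂] [AddCommGroup W₃] [Module ℂ W₃]
  {𝒱 : VertexOperatorAlgebra V}
  {M₁ : VOAModule 𝒱 W₁} {M₂ : VOAModule 𝒱 W₂} {M₃ : VOAModule 𝒱 W₃}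

theorem coeff_mem_wtSpace (I : IntertwiningOperator M₁ M₂ M₃) {w₁ : W₁} {w₂ : W₂} {h₁ h₂ : ℂ}
    (hw₁ : w₁ ∈ M₁.wtSpace h₁) (hw₂ : w₂ ∈ M₂.wtSpace h₂) (n : ℂ) :
    I.coeff w₁ n w₂ ∈ M₃.wtSpace (h₁ + h₂ - n - 1) := by
  rw [VOAModule.mem_wtSpace_iff] at *
  have h0 := (I.jacobi 𝒱.conf).commutator_one w₁ w₂ n
  have h1 := LinearMap.congr_fun (I.deriv w₁ (n + 1)) w₂
  rw [add_sub_cancel_right, LinearMap.smul_apply] at h1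
  have e1 : M₁.mode 𝒱.conf 0 w₁ = M₁.L (-1) w₁ := rfl
  have e2 : M₁.mode 𝒱.conf 1 w₁ = h₁ • w₁ := hw₁
  have e3 : M₂.mode 𝒱.conf 1 w₂ = h₂ • w₂ := hw₂
  rw [e1, h1, e2, e3, map_smul, map_smul, Pi.smul_apply, LinearMap.smul_apply,
    sub_eq_iff_eq_add] at h0
  refine h0.trans ?_
  module

variable (I : IntertwiningOperator M₁ M₂ 𝒱.adjoint) {lam : V →ₗ[ℂ] ℂ}

/-- The opposite mode of ω of index 1 is L(0), so λ ∘ L(0) = 0. -/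
theorem _root_.VOA.IsVacuumFunctional.eq_zero_of_mem (hlam : IsVacuumFunctional 𝒱 lam) {u : V}
    {c : ℂ} (hu : u ∈ 𝒱.adjoint.wtSpace c) (hc : c ≠ 0) : lam u = 0 := by
  have h := hlam 2 𝒱.conf (by exact_mod_cast VOAModule.conf_mem_wtSpace) 1 zero_le_one u
  rw [VOAModule.oppSum_conf_one, (VOAModule.mem_wtSpace_iff _).1 hu, map_smul, smul_eq_mul] at h
  exact (mul_eq_zero.1 h).resolve_left hc

theorem lam_coeff_eq_zero (hlam : IsVacuumFunctional 𝒱 lam) {w₁ : W₁} {w₂ : W₂} {h₁ h₂ : ℂ}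
    (hw₁ : w₁ ∈ M₁.wtSpace h₁) (hw₂ : w₂ ∈ M₂.wtSpace h₂) {n : ℂ} (hn : n ≠ h₁ + h₂ - 1) :
    lam (I.coeff w₁ n w₂) = 0 := by
  refine hlam.eq_zero_of_mem (I.coeff_mem_wtSpace hw₁ hw₂ n) fun h0 => hn ?_
  linear_combination -h0

theorem hasFiniteSupport_lam_coeff (hlam : IsVacuumFunctional 𝒱 lam) (w₁ : W₁) (w₂ : W₂) :
    (fun n => lam (I.coeff w₁ n w₂)).HasFiniteSupport := by
  induction w₁ using M₁.wt_induction with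
  | hom h₁ w₁ hw₁ =>
    induction w₂ using M₂.wt_induction with
    | hom h₂ w₂ hw₂ =>
      refine (Set.finite_singleton (h₁ + h₂ - 1)).subset fun n hn => ?_
      by_contra hne
      exact hn (I.lam_coeff_eq_zero hlam hw₁ hw₂ hne)
    | add w w' h h' =>
      simp only [map_add]
      exact h.add h'
  | add w w' h h' =>
    simp only [map_add, Pi.add_apply, LinearMap.add_apply]
    exact h.add h'

/-- The pairing `λ(I(w₁, x) w₂)` at `x = 1`. -/
def twoPoint (hlam : IsVacuumFunctional 𝒱 lam) : W₁ →ₗ[ℂ] W₂ →ₗ[ℂ] ℂ :=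
  LinearMap.mk₂ ℂ (fun w₁ w₂ => ∑ᶠ n, lam (I.coeff w₁ n w₂))
    (fun w w' w₂ => by
      simp only [map_add, Pi.add_apply, LinearMap.add_apply]
      exact finsum_add_distrib (I.hasFiniteSupport_lam_coeff hlam _ _)
        (I.hasFiniteSupport_lam_coeff hlam _ _))
    (fun c w w₂ => by
      simp only [map_smul, Pi.smul_apply, LinearMap.smul_apply, smul_finsum])
    (fun w₁ w w' => by
      simp only [map_add]
      exact finsum_add_distrib (I.hasFiniteSupport_lam_coeff hlam _ _)
        (I.hasFiniteSupport_lam_coeff hlam _ _))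
    (fun c w₁ w => by simp only [map_smul, smul_finsum])

theorem twoPoint_of_mem (hlam : IsVacuumFunctional 𝒱 lam) {w₁ : W₁} {w₂ : W₂} {h₁ h₂ : ℂ}
    (hw₁ : w₁ ∈ M₁.wtSpace h₁) (hw₂ : w₂ ∈ M₂.wtSpace h₂) {n : ℂ} (hn : n = h₁ + h₂ - 1) :
    I.twoPoint hlam w₁ w₂ = lam (I.coeff w₁ n w₂) :=
  finsum_eq_single _ n fun _ hn' => I.lam_coeff_eq_zero hlam hw₁ hw₂ (hn ▸ hn')

/-- Apply λ to the Jacobi identity for L(1)^s v with parameters l, m = 2j - 2 - l - s and n, and sum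
over s with weights 1/s!. This m turns the modes on the left into those of `oppSum`: of index i ≥ 0
in the first term, which λ kills, and of index l - i in the second. The right side is the conjugated
mode. -/
theorem twoPoint_conjMode_of_mem (hlam : IsVacuumFunctional 𝒱 lam) {v : V} {j : ℤ}
    (hv : v ∈ 𝒱.adjoint.wtSpace (j : ℂ)) (l : ℤ) {w₁ : W₁} {w₂ : W₂} {h₁ h₂ : ℂ}
    (hw₁ : w₁ ∈ M₁.wtSpace h₁) (hw₂ : w₂ ∈ M₂.wtSpace h₂) :
    I.twoPoint hlam (locSum (M₁.conjMode j v l) (M₁.isLocallyFinite_conjMode j v l) w₁) w₂ =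
      -(-1 : ℂ) ^ l * I.twoPoint hlam w₁
        (locSum (fun a : ℕ => (-1 : ℂ) ^ a • ((Ring.choose l a : ℤ) : ℂ) • M₂.oppSum j v (l - a))
          ((M₂.isLocallyFinite_choose_oppSum j v l).smul _) w₂) := by
  obtain ⟨S, hS⟩ := 𝒱.adjoint.isLocallyFinite_L_one_pow v
  -- This n gives weight 0 to every vector in the second and third Jacobi sums, so that λ of them is
  -- a value of `twoPoint`.
  set n : ℂ := h₁ + h₂ - j with hn
  have hmem := VOAModule.L_one_pow_mem_wtSpace_int hv
  have hC : ∀ s : ℕ, I.twoPoint hlam (∑ᶠ i : ℕ, ((Ring.choose (2 * j - 2 - l - s) i : ℤ) : ℂ) •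
      M₁.mode ((𝒱.adjoint.L 1 ^ s) v) (l + i) w₁) w₂ =
      lam (∑ᶠ i : ℕ, ((Ring.choose (2 * j - 2 - l - s) i : ℤ) : ℂ) •
        I.coeff (M₁.mode ((𝒱.adjoint.L 1 ^ s) v) (l + i) w₁)
          (((2 * j - 2 - l - s : ℤ) : ℂ) + n - i) w₂) := fun s => by
    obtain ⟨N, hN⟩ := M₁.isLocallyFinite_mode ((𝒱.adjoint.L 1 ^ s) v) l w₁
    dsimp only at hN
    rw [map_finsum lam (hasFiniteSupport_of_forall_ge (N := N) fun i hi => by simp [hN i hi]),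
      ← LinearMap.flip_apply, map_finsum _
      (hasFiniteSupport_of_forall_ge (N := N) fun i hi => by simp [hN i hi])]
    refine finsum_congr fun i => ?_
    rw [map_smul, map_smul, LinearMap.flip_apply, I.twoPoint_of_mem hlam
      (M₁.mode_mem_wtSpace (hmem s) hw₁ (l + i)) hw₂]
    rw [hn]
    push_cast
    ring
  have hlhs : I.twoPoint hlam
      (locSum (M₁.conjMode j v l) (M₁.isLocallyFinite_conjMode j v l) w₁) w₂ =
      ∑ s ∈ Finset.range S, (1 / (s.factorial : ℂ)) * lam (∑ᶠ i : ℕ,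
        ((-1 : ℂ) ^ i * ((Ring.choose l i : ℤ) : ℂ)) •
          𝒱.adjoint.mode ((𝒱.adjoint.L 1 ^ s) v) (2 * j - 2 - l - s + l - i)
            (I.coeff w₁ (n + i) w₂)) -
      (-1 : ℂ) ^ l * ∑ s ∈ Finset.range S, (1 / (s.factorial : ℂ)) * lam (∑ᶠ i : ℕ,
        ((-1 : ℂ) ^ i * ((Ring.choose l i : ℤ) : ℂ)) •
          I.coeff w₁ (n + l - i)
            (M₂.mode ((𝒱.adjoint.L 1 ^ s) v) (2 * j - 2 - l - s + i) w₂)) := by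
    rw [M₁.locSum_conjMode hS, map_sum, LinearMap.sum_apply, Finset.mul_sum,
      ← Finset.sum_sub_distrib]
    refine Finset.sum_congr rfl fun s _ => ?_
    rw [map_smul, LinearMap.smul_apply, hC, ← I.jacobi _ w₁ w₂ l (2 * j - 2 - l - s) n, map_sub,
      map_smul, smul_eq_mul, smul_eq_mul]
    ring
  have hA : ∑ s ∈ Finset.range S, (1 / (s.factorial : ℂ)) * lam (∑ᶠ i : ℕ,
      ((-1 : ℂ) ^ i * ((Ring.choose l i : ℤ) : ℂ)) •
        𝒱.adjoint.mode ((𝒱.adjoint.L 1 ^ s) v) (2 * j - 2 - l - s + l - i)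
          (I.coeff w₁ (n + i) w₂)) = 0 := by
    obtain ⟨N, hN⟩ := I.truncation w₁ w₂ n
    rw [sum_smul_map_finsum lam S (fun s => 1 / (s.factorial : ℂ))
      (fun i => (-1 : ℂ) ^ i * ((Ring.choose l i : ℤ) : ℂ))
      (fun s i => 𝒱.adjoint.mode ((𝒱.adjoint.L 1 ^ s) v) (2 * j - 2 - l - s + l - i)
          (I.coeff w₁ (n + i) w₂))
      fun s => hasFiniteSupport_of_forall_ge (N := N) fun i hi => by rw [hN i hi, map_zero]]
    refine finsum_eq_zero_of_forall_eq_zero fun i => ?_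
    have h0 := hlam j v hv i (Int.natCast_nonneg i) (I.coeff w₁ (n + i) w₂)
    rw [VOAModule.oppSum_eq_sum _ hS, LinearMap.sum_apply] at h0
    rw [← mul_zero ((-1 : ℂ) ^ i * ((Ring.choose l i : ℤ) : ℂ)), ← h0]
    congr 2
    refine Finset.sum_congr rfl fun s _ => ?_
    rw [LinearMap.smul_apply]
    congr 3
    ring
  have hB : ∑ s ∈ Finset.range S, (1 / (s.factorial : ℂ)) * lam (∑ᶠ i : ℕ,
      ((-1 : ℂ) ^ i * ((Ring.choose l i : ℤ) : ℂ)) •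
        I.coeff w₁ (n + l - i)
          (M₂.mode ((𝒱.adjoint.L 1 ^ s) v) (2 * j - 2 - l - s + i) w₂)) =
      I.twoPoint hlam w₁
        (locSum (fun a : ℕ => (-1 : ℂ) ^ a • ((Ring.choose l a : ℤ) : ℂ) • M₂.oppSum j v (l - a))
          ((M₂.isLocallyFinite_choose_oppSum j v l).smul _) w₂) := by
    rw [sum_smul_map_finsum lam S (fun s => 1 / (s.factorial : ℂ))
      (fun i => (-1 : ℂ) ^ i * ((Ring.choose l i : ℤ) : ℂ))
      (fun s i => I.coeff w₁ (n + l - i)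
          (M₂.mode ((𝒱.adjoint.L 1 ^ s) v) (2 * j - 2 - l - s + i) w₂))
      fun s => by
        obtain ⟨N, hN⟩ := M₂.isLocallyFinite_mode ((𝒱.adjoint.L 1 ^ s) v) (2 * j - 2 - l - s) w₂
        exact hasFiniteSupport_of_forall_ge (N := N) fun i hi => by
          rw [hN i hi, map_zero],
      locSum_apply, map_finsum _
        (((M₂.isLocallyFinite_choose_oppSum j v l).smul _).hasFiniteSupport w₂)]
    refine finsum_congr fun i => ?_
    rw [LinearMap.smul_apply, LinearMap.smul_apply, map_smul, map_smul, smul_eq_mul, smul_eq_mul,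
      ← mul_assoc, I.twoPoint_of_mem hlam hw₁ (M₂.oppSum_mem_wtSpace hv hw₂ (l - i))
      (n := n + l - i) (by rw [hn]; push_cast; ring), VOAModule.oppSum_eq_sum _ hS,
      LinearMap.sum_apply, map_sum (I.coeff w₁ (n + l - i))]
    congr 2
    refine Finset.sum_congr rfl fun s _ => ?_
    rw [LinearMap.smul_apply, map_smul]
    congr 4
    ring
  rw [hlhs, hA, hB]
  ring

theorem _root_.VOA.bilin_ext_wt (M₁ : VOAModule 𝒱 W₁) (M₂ : VOAModule 𝒱 W₂)
    {A B : W₁ →ₗ[ℂ] W₂ →ₗ[ℂ] ℂ} (h : ∀ h₁, ∀ w₁ ∈ M₁.wtSpace h₁, ∀ h₂, ∀ w₂ ∈ M₂.wtSpace h₂,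
      A w₁ w₂ = B w₁ w₂) : A = B := by
  ext w₁ w₂
  induction w₁ using M₁.wt_induction with
  | hom h₁ w₁ hw₁ =>
    induction w₂ using M₂.wt_induction with
    | hom h₂ w₂ hw₂ => exact h _ _ hw₁ _ _ hw₂
    | add w w' h h' => rw [map_add, map_add, h, h']
  | add w w' h h' => rw [map_add, map_add, LinearMap.add_apply, LinearMap.add_apply, h, h']

theorem twoPoint_conjMode (hlam : IsVacuumFunctional 𝒱 lam) {v : V} {j : ℤ}
    (hv : v ∈ 𝒱.adjoint.wtSpace (j : ℂ)) (l : ℤ) (w₁ : W₁) (w₂ : W₂) :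
    I.twoPoint hlam (locSum (M₁.conjMode j v l) (M₁.isLocallyFinite_conjMode j v l) w₁) w₂ =
      -(-1 : ℂ) ^ l * I.twoPoint hlam w₁
        (locSum (fun a : ℕ => (-1 : ℂ) ^ a • ((Ring.choose l a : ℤ) : ℂ) • M₂.oppSum j v (l - a))
          ((M₂.isLocallyFinite_choose_oppSum j v l).smul _) w₂) := by
  have h := bilin_ext_wt M₁ M₂
    (A := (I.twoPoint hlam).comp
      (locSum (M₁.conjMode j v l) (M₁.isLocallyFinite_conjMode j v l)))
    (B := (-(-1 : ℂ) ^ l) • (I.twoPoint hlam).compl₂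
      (locSum (fun a : ℕ => (-1 : ℂ) ^ a • ((Ring.choose l a : ℤ) : ℂ) • M₂.oppSum j v (l - a))
          ((M₂.isLocallyFinite_choose_oppSum j v l).smul _)))
    fun h₁ w₁ hw₁ h₂ w₂ hw₂ => I.twoPoint_conjMode_of_mem hlam hv l hw₁ hw₂
  exact LinearMap.congr_fun (LinearMap.congr_fun h w₁) w₂

/-- The pairing `λ(I(e^{L(1)} w₁, 1) e^{-L(1)} w₂)`. -/
def expPairing (hlam : IsVacuumFunctional 𝒱 lam) : W₁ →ₗ[ℂ] W₂ →ₗ[ℂ] ℂ :=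
  (I.twoPoint hlam).compl₁₂ (M₁.expL 1) (M₂.expL (-1))

theorem expPairing_apply (hlam : IsVacuumFunctional 𝒱 lam) (w₁ : W₁) (w₂ : W₂) :
    I.expPairing hlam w₁ w₂ = I.twoPoint hlam (M₁.expL 1 w₁) (M₂.expL (-1) w₂) := rfl

theorem expPairing_mode (hlam : IsVacuumFunctional 𝒱 lam) {v : V} {j : ℤ}
    (hv : v ∈ 𝒱.adjoint.wtSpace (j : ℂ)) (l : ℤ) (w₁ : W₁) (w₂ : W₂) :
    I.expPairing hlam (M₁.mode v l w₁) w₂ =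
      -(-1 : ℂ) ^ l * I.expPairing hlam w₁ (M₂.oppSum j v l w₂) := by
  rw [expPairing_apply, expPairing_apply, M₁.expL_mode hv, M₂.expL_neg_oppSum hv,
    I.twoPoint_conjMode hlam hv]

theorem expPairing_eq_zero_of_ne (hlam : IsVacuumFunctional 𝒱 lam) {w₁ : W₁} {w₂ : W₂} {h₁ h₂ : ℂ}
    (hw₁ : w₁ ∈ M₁.wtSpace h₁) (hw₂ : w₂ ∈ M₂.wtSpace h₂) (hne : h₁ ≠ h₂) :
    I.expPairing hlam w₁ w₂ = 0 := by
  have h := I.expPairing_mode hlam (v := 𝒱.conf) (j := 2)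
    (by exact_mod_cast VOAModule.conf_mem_wtSpace) 1 w₁ w₂
  have e : M₁.mode 𝒱.conf 1 w₁ = h₁ • w₁ := (VOAModule.mem_wtSpace_iff _).1 hw₁
  rw [e, M₂.oppSum_conf_one, (VOAModule.mem_wtSpace_iff _).1 hw₂, map_smul, map_smul,
    LinearMap.smul_apply] at h
  have h' : (h₁ - h₂) * I.expPairing hlam w₁ w₂ = 0 := by
    simp only [smul_eq_mul, zpow_one] at h
    linear_combination h
  exact (mul_eq_zero.1 h').resolve_left (sub_ne_zero.2 hne)

theorem twoPoint_eq_zero_of_expPairing_eq_zero (hlam : IsVacuumFunctional 𝒱 lam)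
    (h : I.expPairing hlam = 0) : I.twoPoint hlam = 0 := by
  ext w₁ w₂
  have h0 := LinearMap.congr_fun (LinearMap.congr_fun h (M₁.expL (-1) w₁)) (M₂.expL 1 w₂)
  rw [expPairing_apply] at h0
  have e₁ : M₁.expL 1 (M₁.expL (-1) w₁) = w₁ := locExp_one_locExp_neg_one _ _ _
  have e₂ : M₂.expL (-1) (M₂.expL 1 w₂) = w₂ := locExp_neg_one_locExp_one _ _ _
  rwa [e₁, e₂] at h0

theorem lam_coeff_eq_zero_of_twoPoint_eq_zero (hlam : IsVacuumFunctional 𝒱 lam)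
    (h : I.twoPoint hlam = 0) (w₁ : W₁) (n : ℂ) (w₂ : W₂) : lam (I.coeff w₁ n w₂) = 0 := by
  induction w₁ using M₁.wt_induction with
  | hom h₁ w₁ hw₁ =>
    induction w₂ using M₂.wt_induction with
    | hom h₂ w₂ hw₂ =>
      by_cases hn : n = h₁ + h₂ - 1
      · rw [← I.twoPoint_of_mem hlam hw₁ hw₂ hn, h]; rfl
      · exact I.lam_coeff_eq_zero hlam hw₁ hw₂ hn
    | add w w' h h' => rw [map_add, map_add, h, h', add_zero]
  | add w w' h h' =>
    rw [map_add, Pi.add_apply, LinearMap.add_apply, map_add, h, h', add_zero]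

/-- The commutator formula expresses v_m I(w₁)_n w₂ through coefficients of I alone, namely those at
(w₁, v_m w₂) and at (v_i w₁, w₂). -/
theorem lam_mode_coeff_eq_zero (h : ∀ (w₁ : W₁) (n : ℂ) (w₂ : W₂), lam (I.coeff w₁ n w₂) = 0)
    (v : V) (m : ℤ) (w₁ : W₁) (n : ℂ) (w₂ : W₂) :
    lam (𝒱.adjoint.mode v m (I.coeff w₁ n w₂)) = 0 := by
  have h0 := congr_arg lam ((I.jacobi v).commutator w₁ w₂ m n)
  obtain ⟨N, hN⟩ := M₁.isLocallyFinite_mode v 0 w₁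
  rw [map_sub, h, sub_zero, map_finsum lam (hasFiniteSupport_of_forall_ge (N := N) fun i hi => by
    have := hN i hi
    dsimp only at this
    rw [zero_add] at this
    simp [this])] at h0
  rw [h0]
  exact finsum_eq_zero_of_forall_eq_zero fun i => by rw [map_smul, h, smul_zero]

end IntertwiningOperator

theorem finsum_exp_neg_mul_exp {W : Type*} [AddCommGroup W] [Module ℂ W] {F : ℕ → W} {N : ℕ}
    (hF : ∀ n, N ≤ n → F n = 0) :
    ∑ᶠ p : ℕ, ∑ᶠ q : ℕ, (((-1) ^ p * (1 / (p.factorial : ℂ))) * (1 / (q.factorial : ℂ))) •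
      F (p + q) = F 0 := by
  have h := finsum_exp_mul_exp_neg (F := fun n => (-1 : ℂ) ^ n • F n) (N := N)
    fun n hn => by rw [hF n hn, smul_zero]
  simp only [pow_zero, one_smul] at h
  rw [← h]
  refine finsum_congr fun p => finsum_congr fun q => ?_
  rw [smul_smul]
  congr 1
  have : (-1 : ℂ) ^ q * (-1) ^ q = 1 := by rw [← mul_pow]; norm_num
  rw [pow_add]
  linear_combination (-(1 / (p.factorial : ℂ)) * (1 / (q.factorial : ℂ)) * (-1) ^ p) * this

/-! ### The residue pairing and its invariance -/

namespace IntertwiningOperator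

variable {V W₁ W₂ W₃ : Type*} [AddCommGroup V] [Module ℂ V]
  [AddCommGroup W₁] [Module ℂ W₁] [AddCommGroup W₂] [Module ℂ W₂] [AddCommGroup W₃] [Module ℂ W₃]
  {𝒱 : VertexOperatorAlgebra V}
  {M₁ : VOAModule 𝒱 W₁} {M₂ : VOAModule 𝒱 W₂} {M₃ : VOAModule 𝒱 W₃}

section Opp

variable (I : IntertwiningOperator M₁ M₂ M₃)

/-- The series `I(e^{xL(1)} x^{-2h} w, x⁻¹)`; the value at `p` is the coefficient of `x^p`. -/
def oppSeries (h p : ℂ) (w : W₁) : W₂ →ₗ[ℂ] W₃ :=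
  ∑ᶠ k : ℕ, (1 / (k.factorial : ℂ)) • I.coeff ((M₁.L 1 ^ k) w) (p - 1 - k + 2 * h)

theorem hasFiniteSupport_oppSeries (h p : ℂ) (w : W₁) : (fun k : ℕ =>
    (1 / (k.factorial : ℂ)) • I.coeff ((M₁.L 1 ^ k) w) (p - 1 - k + 2 * h)).HasFiniteSupport := by
  obtain ⟨N, hN⟩ := M₁.isLocallyFinite_L_one_pow w
  refine hasFiniteSupport_of_forall_ge (N := N) fun k hk => ?_
  rw [hN k hk, map_zero, Pi.zero_apply, smul_zero]

theorem oppSeries_add (h p : ℂ) (w w' : W₁) :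
    I.oppSeries h p (w + w') = I.oppSeries h p w + I.oppSeries h p w' := by
  rw [oppSeries, oppSeries, oppSeries, ← finsum_add_distrib (I.hasFiniteSupport_oppSeries h p w)
    (I.hasFiniteSupport_oppSeries h p w')]
  simp only [map_add, Pi.add_apply, smul_add]

theorem oppSeries_smul (h p c : ℂ) (w : W₁) :
    I.oppSeries h p (c • w) = c • I.oppSeries h p w := by
  rw [oppSeries, oppSeries, smul_finsum]
  simp only [map_smul, Pi.smul_apply, smul_comm c]

theorem oppSeries_zero (h p : ℂ) : I.oppSeries h p 0 = 0 := by
  simp [oppSeries]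

theorem opp_eq (r : ℤ) (w : W₁) (p : ℂ) : I.opp r w p =
    ∑ᶠ h : ℂ, Complex.exp ((2 * r + 1) * Real.pi * Complex.I * h) •
      I.oppSeries h p (M₁.wtProj h w) := rfl

theorem opp_add (r : ℤ) (w w' : W₁) (p : ℂ) : I.opp r (w + w') p = I.opp r w p + I.opp r w' p := by
  have hfin : ∀ w : W₁, (fun h : ℂ => Complex.exp ((2 * r + 1) * Real.pi * Complex.I * h) •
      I.oppSeries h p (M₁.wtProj h w)).HasFiniteSupport := fun w =>
    (M₁.hasFiniteSupport_wtProj w).subset fun h hh h0 => hh (by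
      have h1 : M₁.wtProj h w = 0 := h0
      simp only [h1, oppSeries_zero, smul_zero])
  rw [opp_eq, opp_eq, opp_eq, ← finsum_add_distrib (hfin w) (hfin w')]
  simp only [map_add, oppSeries_add, smul_add]

theorem opp_smul (r : ℤ) (c : ℂ) (w : W₁) (p : ℂ) : I.opp r (c • w) p = c • I.opp r w p := by
  rw [opp_eq, opp_eq, smul_finsum]
  simp only [map_smul, oppSeries_smul, smul_comm c]

theorem opp_of_mem {w : W₁} {h : ℂ} (hw : w ∈ M₁.wtSpace h) (r : ℤ) (p : ℂ) :
    I.opp r w p = Complex.exp ((2 * r + 1) * Real.pi * Complex.I * h) • I.oppSeries h p w := by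
  rw [opp_eq, finsum_eq_single _ h, M₁.wtProj_of_mem hw]
  intro h' hne
  rw [M₁.wtProj_of_mem_ne hw hne, oppSeries_zero, smul_zero]

end Opp

section ContForm

variable (I : IntertwiningOperator M₁ M₂ 𝒱.adjoint) (form : V →ₗ[ℂ] V →ₗ[ℂ] ℂ)

/-- The residue picks the constant term, so x^j from e^{xL(1)} meets x^{-j} from the opposite
series. The substitution e^{πi} x contributes e^{-πij} = (-1)^j, which changes e^{L(1)} into
e^{-L(1)}. -/
theorem contForm_eq (w₁ : W₁) (w₂ : W₂) : I.contForm form w₁ w₂ =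
    ∑ᶠ j : ℕ, ((-1 : ℂ) ^ j * (1 / (j.factorial : ℂ))) *
      form 𝒱.vac (I.opp 0 w₁ (-j) ((M₂.L 1 ^ j) w₂)) := by
  refine finsum_congr fun j => ?_
  have h1 : (-1 : ℂ) - -1 - j = -j := by ring
  have h2 : Complex.exp (Real.pi * Complex.I * -j) = (-1) ^ j := by
    rw [show (Real.pi : ℂ) * Complex.I * -j = j * (-(Real.pi * Complex.I)) by ring,
      Complex.exp_nat_mul, Complex.exp_neg, Complex.exp_pi_mul_I]
    norm_num
  simp only [substExp]
  rw [h1, h2]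
  simp only [LinearMap.smul_apply, map_smul, smul_eq_mul]
  ring

theorem hasFiniteSupport_contForm (w₁ : W₁) (w₂ : W₂) :
    (fun j : ℕ => ((-1 : ℂ) ^ j * (1 / (j.factorial : ℂ))) *
      form 𝒱.vac (I.opp 0 w₁ (-j) ((M₂.L 1 ^ j) w₂))).HasFiniteSupport := by
  obtain ⟨N, hN⟩ := M₂.isLocallyFinite_L_one_pow w₂
  refine hasFiniteSupport_of_forall_ge (N := N) fun k hk => ?_
  rw [hN k hk, map_zero, map_zero, mul_zero]

/-- The pairing `Res_x x⁻¹ (𝟏, I^o_0(w₁, e^{πi} x) e^{xL(1)} w₂)_V` as a bilinear map. -/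
def contPairing : W₁ →ₗ[ℂ] W₂ →ₗ[ℂ] ℂ :=
  LinearMap.mk₂ ℂ (I.contForm form)
    (fun w w' w₂ => by
      rw [contForm_eq, contForm_eq, contForm_eq,
        ← finsum_add_distrib (I.hasFiniteSupport_contForm form w w₂)
          (I.hasFiniteSupport_contForm form w' w₂)]
      simp only [opp_add, LinearMap.add_apply, map_add, mul_add])
    (fun c w w₂ => by
      rw [contForm_eq, contForm_eq, smul_finsum]
      simp only [opp_smul, LinearMap.smul_apply, map_smul, smul_eq_mul, mul_left_comm c])
    (fun w₁ w w' => by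
      rw [contForm_eq, contForm_eq, contForm_eq,
        ← finsum_add_distrib (I.hasFiniteSupport_contForm form w₁ w)
          (I.hasFiniteSupport_contForm form w₁ w')]
      simp only [map_add, mul_add])
    (fun c w₁ w => by
      rw [contForm_eq, contForm_eq, smul_finsum]
      simp only [map_smul, smul_eq_mul, mul_left_comm c])

theorem contPairing_apply (w₁ : W₁) (w₂ : W₂) :
    I.contPairing form w₁ w₂ = I.contForm form w₁ w₂ := rfl

theorem contPairing_of_mem_mem (hlam : IsVacuumFunctional 𝒱 (form 𝒱.vac)) {w₁ : W₁} {w₂ : W₂}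
    {h₁ h₂ : ℂ} (hw₁ : w₁ ∈ M₁.wtSpace h₁) (hw₂ : w₂ ∈ M₂.wtSpace h₂) :
    I.contPairing form w₁ w₂ =
      Complex.exp (Real.pi * Complex.I * h₁) * I.expPairing hlam w₁ w₂ := by
  have key : I.contPairing form w₁ w₂ = ∑ᶠ j : ℕ, Complex.exp (Real.pi * Complex.I * h₁) *
      (((-1 : ℂ) ^ j * (1 / (j.factorial : ℂ))) * ∑ᶠ k : ℕ, (1 / (k.factorial : ℂ)) *
        form 𝒱.vac (I.coeff ((M₁.L 1 ^ k) w₁) (-j - 1 - k + 2 * h₁) ((M₂.L 1 ^ j) w₂))) := by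
    rw [contPairing_apply, contForm_eq]
    refine finsum_congr fun j => ?_
    rw [I.opp_of_mem hw₁, LinearMap.smul_apply, map_smul, smul_eq_mul, Int.cast_zero, mul_zero,
      zero_add, one_mul, mul_left_comm]
    congr 2
    have h1 := map_finsum ((form 𝒱.vac).comp (LinearMap.applyₗ ((M₂.L 1 ^ j) w₂)))
      (I.hasFiniteSupport_oppSeries h₁ (-j) w₁)
    refine h1.trans (finsum_congr fun k => ?_)
    simp
  rw [key]
  -- The index -j - 1 - k + 2h₁ equals the only index (h₁ - k) + (h₂ - j) - 1 that λ can detect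
  -- exactly when h₁ = h₂.
  by_cases hne : h₁ = h₂
  · subst hne
    rw [← mul_finsum, expPairing_apply]
    congr 1
    have e₁ : M₁.expL 1 w₁ = ∑ᶠ k : ℕ, ((1 : ℂ) ^ k * (1 / (k.factorial : ℂ))) •
      (M₁.L 1 ^ k) w₁ := rfl
    have e₂ : M₂.expL (-1) w₂ = ∑ᶠ k : ℕ, ((-1 : ℂ) ^ k * (1 / (k.factorial : ℂ))) •
      (M₂.L 1 ^ k) w₂ := rfl
    have f₁ : (fun k : ℕ => ((1 : ℂ) ^ k * (1 / (k.factorial : ℂ))) •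
      (M₁.L 1 ^ k) w₁).HasFiniteSupport :=
      (M₁.isLocallyFinite_L_one_pow.smul _).hasFiniteSupport w₁
    have f₂ : (fun k : ℕ => ((-1 : ℂ) ^ k * (1 / (k.factorial : ℂ))) •
      (M₂.L 1 ^ k) w₂).HasFiniteSupport :=
      (M₂.isLocallyFinite_L_one_pow.smul _).hasFiniteSupport w₂
    rw [e₂, map_finsum _ f₂]
    refine finsum_congr fun j => ?_
    rw [map_smul, smul_eq_mul, e₁, ← LinearMap.flip_apply, map_finsum _ f₁]
    congr 1
    refine finsum_congr fun k => ?_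
    rw [map_smul, smul_eq_mul, one_pow, one_mul, LinearMap.flip_apply, I.twoPoint_of_mem hlam
      (M₁.L_one_pow_mem_wtSpace hw₁ k) (M₂.L_one_pow_mem_wtSpace hw₂ j)]
    ring
  · rw [I.expPairing_eq_zero_of_ne hlam hw₁ hw₂ hne, mul_zero]
    refine finsum_eq_zero_of_forall_eq_zero fun j => ?_
    rw [finsum_eq_zero_of_forall_eq_zero, mul_zero, mul_zero]
    intro k
    rw [I.lam_coeff_eq_zero hlam (M₁.L_one_pow_mem_wtSpace hw₁ k)
      (M₂.L_one_pow_mem_wtSpace hw₂ j), mul_zero]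
    intro h0
    refine hne ?_
    linear_combination h0

theorem contPairing_of_mem (hlam : IsVacuumFunctional 𝒱 (form 𝒱.vac)) {w₁ : W₁}
    {h : ℂ} (hw₁ : w₁ ∈ M₁.wtSpace h) (w₂ : W₂) :
    I.contPairing form w₁ w₂ =
      Complex.exp (Real.pi * Complex.I * h) * I.expPairing hlam w₁ w₂ := by
  induction w₂ using M₂.wt_induction with
  | hom h₂ w₂ hw₂ => exact I.contPairing_of_mem_mem form hlam hw₁ hw₂
  | add w w' h h' => rw [map_add, map_add, h, h', mul_add]

/-- The mode v_n shifts the weight by j - n - 1, so e^{πih} changes by (-1)^{j-n-1}. Together with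
the factor -(-1)^n of `expPairing_mode` this is the sign (-1)^j in v^o_n. -/
theorem isInvariant_contPairing (hlam : IsVacuumFunctional 𝒱 (form 𝒱.vac)) :
    VOAModule.IsInvariant M₁ M₂ (I.contPairing form) := by
  intro v n w₁ w₂
  induction v using VOAModule.int_wt_induction 𝒱 with
  | hom j v hv =>
    induction w₁ using M₁.wt_induction with
    | hom h w₁ hw₁ =>
      have e : Complex.exp (Real.pi * Complex.I * (h + j - n - 1)) =
          Complex.exp (Real.pi * Complex.I * h) * (-1) ^ (j - n - 1) := by
        rw [← Complex.exp_pi_mul_I, ← Complex.exp_int_mul, ← Complex.exp_add]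
        congr 1
        push_cast
        ring
      have e' : (-1 : ℂ) ^ (j - n - 1) * -(-1) ^ n = (-1) ^ j := by
        rw [zpow_sub₀ (by norm_num), zpow_sub₀ (by norm_num)]
        have : (-1 : ℂ) ^ n ≠ 0 := zpow_ne_zero _ (by norm_num)
        field_simp
      rw [I.contPairing_of_mem form hlam (M₁.mode_mem_wtSpace hv hw₁ n),
        I.contPairing_of_mem form hlam hw₁, I.expPairing_mode hlam hv, M₂.oppMode_of_mem hv,
        LinearMap.smul_apply, map_smul, smul_eq_mul, e, ← e']
      ring
    | add w w' h h' => rw [map_add, map_add, LinearMap.add_apply, h, h', map_add,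
        LinearMap.add_apply]
  | add v v' h h' =>
    rw [M₁.mode_add, M₂.oppMode_add, LinearMap.add_apply, LinearMap.add_apply, map_add, map_add,
      LinearMap.add_apply, h, h']

/-! ### The functional (𝟏, ·)_V and nonvanishing of the pairing -/

variable {form}

theorem isVacuumFunctional_form (hinv : VOAModule.IsInvariant 𝒱.adjoint 𝒱.adjoint form) :
    IsVacuumFunctional 𝒱 (form 𝒱.vac) := by
  intro j v hv n hn u
  have h := hinv v n 𝒱.vac u
  have h0 : 𝒱.adjoint.mode v n 𝒱.vac = 0 := 𝒱.creation_nonneg v n hn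
  rw [h0, map_zero, VOAModule.oppMode_of_mem _ hv, LinearMap.smul_apply, map_smul, smul_eq_mul,
    LinearMap.zero_apply] at h
  exact (mul_eq_zero.1 h.symm).resolve_left (zpow_ne_zero _ (by norm_num))

/-- As v = v_{-1} 𝟏, invariance gives (v, u) = (𝟏, v^o_{-1} u), and v^o_{-1} is a combination of
ordinary modes. -/
theorem eq_zero_of_form_vac_mode (hinv : VOAModule.IsInvariant 𝒱.adjoint 𝒱.adjoint form)
    (hnondeg : form.Nondegenerate) {u : V}
    (hu : ∀ (v : V) (n : ℤ), form 𝒱.vac (𝒱.adjoint.mode v n u) = 0) : u = 0 := by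
  refine hnondeg.2 u fun v => ?_
  induction v using VOAModule.int_wt_induction 𝒱 with
  | hom j v hv =>
    have h := hinv v (-1) 𝒱.vac u
    have h0 : 𝒱.adjoint.mode v (-1) 𝒱.vac = v := 𝒱.creation v
    obtain ⟨S, hS⟩ := 𝒱.adjoint.isLocallyFinite_L_one_pow v
    rw [h0, VOAModule.oppMode_of_mem _ hv, LinearMap.smul_apply, map_smul,
      VOAModule.oppSum_eq_sum _ hS, LinearMap.sum_apply, map_sum] at h
    rw [h, Finset.sum_eq_zero, smul_zero]
    intro k _
    rw [LinearMap.smul_apply, map_smul, hu, smul_zero]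
  | add v v' h h' => rw [map_add, LinearMap.add_apply, h, h', add_zero]

theorem contPairing_ne_zero (hinv : VOAModule.IsInvariant 𝒱.adjoint 𝒱.adjoint form)
    (hnondeg : form.Nondegenerate) (hI : I.coeff ≠ 0) : I.contPairing form ≠ 0 := by
  intro h0
  have hlam := isVacuumFunctional_form hinv
  have h1 : I.expPairing hlam = 0 := bilin_ext_wt M₁ M₂ fun h₁ w₁ hw₁ _ w₂ _ => by
    have h := I.contPairing_of_mem form hlam hw₁ w₂
    rw [h0] at h
    exact (mul_eq_zero.1 h.symm).resolve_left (Complex.exp_ne_zero _)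
  have h2 := I.lam_coeff_eq_zero_of_twoPoint_eq_zero hlam
    (I.twoPoint_eq_zero_of_expPairing_eq_zero hlam h1)
  refine hI (LinearMap.ext fun w₁ => funext fun n => LinearMap.ext fun w₂ => ?_)
  exact eq_zero_of_form_vac_mode hinv hnondeg fun v m => I.lam_mode_coeff_eq_zero h2 v m w₁ n w₂

end ContForm

end IntertwiningOperator

/-! ### Invariant pairings, nondegeneracy and contragredients -/

namespace VOAModule

variable {V W₁ W₂ : Type*} [AddCommGroup V] [Module ℂ V]
  [AddCommGroup W₁] [Module ℂ W₁] [AddCommGroup W₂] [Module ℂ W₂]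
  {𝒱 : VertexOperatorAlgebra V} {M₁ : VOAModule 𝒱 W₁} {M₂ : VOAModule 𝒱 W₂}
  {B : W₁ →ₗ[ℂ] W₂ →ₗ[ℂ] ℂ}

theorem IsInvariant.eq_zero_of_ne (hB : IsInvariant M₁ M₂ B) {w₁ : W₁} {w₂ : W₂} {h₁ h₂ : ℂ}
    (hw₁ : w₁ ∈ M₁.wtSpace h₁) (hw₂ : w₂ ∈ M₂.wtSpace h₂) (hne : h₁ ≠ h₂) : B w₁ w₂ = 0 := by
  have h := hB 𝒱.conf 1 w₁ w₂
  have e : M₁.mode 𝒱.conf 1 w₁ = h₁ • w₁ := (mem_wtSpace_iff _).1 hw₁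
  rw [e, M₂.oppMode_conf_one, (mem_wtSpace_iff _).1 hw₂, map_smul, map_smul,
    LinearMap.smul_apply, smul_eq_mul, smul_eq_mul] at h
  have h' : (h₁ - h₂) * B w₁ w₂ = 0 := by linear_combination h
  exact (mul_eq_zero.1 h').resolve_left (sub_ne_zero.2 hne)

/-- Taking the opposite operator twice gives back Y: applying invariance to each term of v^o_n
produces a second exponential of L(1), with alternating signs between the two, and they cancel by
`finsum_exp_neg_mul_exp`. -/
theorem IsInvariant.flip (hB : IsInvariant M₁ M₂ B) : IsInvariant M₂ M₁ B.flip := by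
  intro v n w₂ w₁
  rw [LinearMap.flip_apply, LinearMap.flip_apply]
  induction v using int_wt_induction 𝒱 with
  | hom j v hv =>
    obtain ⟨S, hS⟩ := 𝒱.adjoint.isLocallyFinite_L_one_pow v
    dsimp only at hS
    have hF := finsum_exp_neg_mul_exp
      (F := fun N : ℕ => B w₁ (M₂.mode ((𝒱.adjoint.L 1 ^ N) v) (n - N) w₂)) (N := S)
      fun N hN => by rw [hS N hN, mode_zero, LinearMap.zero_apply, map_zero]
    simp only [pow_zero, Module.End.one_apply, Nat.cast_zero, sub_zero] at hF
    rw [← hF, M₁.oppMode_of_mem hv, M₁.oppSum_eq_sum hS, LinearMap.smul_apply, map_smul,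
      LinearMap.sum_apply, map_sum, LinearMap.smul_apply, LinearMap.sum_apply, Finset.smul_sum,
      finsum_eq_sum_range (N := S)]
    · refine Finset.sum_congr rfl fun k _ => ?_
      have hS' : ∀ i, S ≤ i → (𝒱.adjoint.L 1 ^ i) ((𝒱.adjoint.L 1 ^ k) v) = 0 := fun i hi => by
        rw [← Module.End.mul_apply, ← pow_add, hS _ (by omega)]
      rw [LinearMap.smul_apply, map_smul, LinearMap.smul_apply, hB,
        M₂.oppMode_of_mem (L_one_pow_mem_wtSpace_int hv k), M₂.oppSum_eq_sum hS',
        LinearMap.smul_apply, map_smul, LinearMap.sum_apply, map_sum, finsum_eq_sum_range (N := S)]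
      · rw [Finset.smul_sum, Finset.smul_sum, Finset.smul_sum]
        refine Finset.sum_congr rfl fun i _ => ?_
        -- L(1)^k v has weight j - k, so the two signs combine to (-1)^k; the two index reflections
        -- return to n - (k + i).
        have e1 : (-1 : ℂ) ^ j * (-1) ^ (j - k : ℤ) = (-1) ^ k := by
          rw [← zpow_add₀ (by norm_num), show j + (j - k) = 2 * (j - k) + k by ring,
            zpow_add₀ (by norm_num), zpow_mul, zpow_natCast]
          norm_num
        have e2 : 2 * (j - k) - i - (2 * j - k - n - 2) - 2 = n - ((k + i : ℕ) : ℤ) := by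
          push_cast; ring
        rw [LinearMap.smul_apply, map_smul, e2, ← Module.End.mul_apply, ← pow_add, add_comm i k,
          ← e1]
        simp only [smul_eq_mul]
        ring
      · intro i hi
        rw [hS _ (by omega), mode_zero, LinearMap.zero_apply, map_zero, smul_zero]
    · intro k hk
      refine finsum_eq_zero_of_forall_eq_zero fun i => ?_
      rw [hS _ (by omega), mode_zero, LinearMap.zero_apply, map_zero, smul_zero]
  | add v v' h h' =>
    rw [M₂.mode_add, M₁.oppMode_add, LinearMap.add_apply, LinearMap.add_apply, map_add, map_add,
      LinearMap.add_apply, h, h']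

/-- By invariance the left kernel is stable under all modes, hence is 0 or everything. -/
theorem IsInvariant.separatingLeft (hB : IsInvariant M₁ M₂ B) (hM₁ : M₁.IsIrreducible)
    (h0 : B ≠ 0) : B.SeparatingLeft := by
  have hker : LinearMap.ker B = ⊥ := by
    refine (hM₁.2 (LinearMap.ker B) fun v n w hw => ?_).resolve_right fun htop => h0 ?_
    · rw [LinearMap.mem_ker] at hw ⊢
      ext w₂
      rw [hB, hw]
      rfl
    · exact LinearMap.ker_eq_top.1 htop
  exact LinearMap.separatingLeft_iff_ker_eq_bot.2 hker

theorem IsInvariant.nondegenerate (hB : IsInvariant M₁ M₂ B) (hM₁ : M₁.IsIrreducible)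
    (hM₂ : M₂.IsIrreducible) (h0 : B ≠ 0) : B.Nondegenerate := by
  refine ⟨hB.separatingLeft hM₁ h0, ?_⟩
  rw [← LinearMap.flip_separatingLeft]
  refine hB.flip.separatingLeft hM₂ fun h => h0 ?_
  ext w₁ w₂
  exact LinearMap.congr_fun (LinearMap.congr_fun h w₂) w₁

theorem IsInvariant.mem_gradedDual (hB : IsInvariant M₁ M₂ B) (w₁ : W₁) :
    B w₁ ∈ M₂.gradedDual := by
  induction w₁ using M₁.wt_induction with
  | hom h w₁ hw₁ =>
    refine (Set.finite_singleton h).subset ?_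
    rintro h' ⟨w₂, hw₂, hne⟩
    by_contra hh
    exact hne (hB.eq_zero_of_ne hw₁ hw₂ (Ne.symm hh))
  | add w w' h h' => rw [map_add]; exact add_mem h h'

/-- Orthogonality of distinct weights makes the restriction to weight h injective on both sides,
hence perfect in finite dimension. -/
theorem IsInvariant.exists_eq_on_wtSpace (hB : IsInvariant M₁ M₂ B) (hnd : B.Nondegenerate)
    (f : Dual ℂ W₂) (h : ℂ) : ∃ w₁ ∈ M₁.wtSpace h, ∀ w₂ ∈ M₂.wtSpace h, B w₁ w₂ = f w₂ := by
  have : FiniteDimensional ℂ (M₁.wtSpace h) := M₁.finite_dim h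
  have : FiniteDimensional ℂ (M₂.wtSpace h) := M₂.finite_dim h
  set b : M₁.wtSpace h →ₗ[ℂ] M₂.wtSpace h →ₗ[ℂ] ℂ :=
    B.compl₁₂ (M₁.wtSpace h).subtype (M₂.wtSpace h).subtype with hb
  have hl : Function.Injective b := by
    rw [injective_iff_map_eq_zero]
    intro w₁ hw
    refine Subtype.ext (hnd.1 w₁ fun w₂ => ?_)
    induction w₂ using M₂.wt_induction with
    | hom h₂ w₂ hw₂ =>
      by_cases hh : h = h₂
      · subst hh
        exact LinearMap.congr_fun hw ⟨w₂, hw₂⟩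
      · exact hB.eq_zero_of_ne w₁.2 hw₂ hh
    | add w w' h h' => rw [map_add, h, h', add_zero]
  have hr : Function.Injective b.flip := by
    rw [injective_iff_map_eq_zero]
    intro w₂ hw
    refine Subtype.ext (hnd.2 w₂ fun w₁ => ?_)
    induction w₁ using M₁.wt_induction with
    | hom h₁ w₁ hw₁ =>
      by_cases hh : h₁ = h
      · subst hh
        exact LinearMap.congr_fun hw ⟨w₁, hw₁⟩
      · exact hB.eq_zero_of_ne hw₁ w₂.2 hh
    | add w w' h h' => rw [map_add, LinearMap.add_apply, h, h', add_zero]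
  have : b.IsPerfPair := LinearMap.IsPerfPair.of_injective hl hr
  obtain ⟨w₁, hw₁⟩ := (LinearMap.IsPerfPair.bijective_left b).2 (f ∘ₗ (M₂.wtSpace h).subtype)
  exact ⟨w₁, w₁.2, fun w₂ hw₂ => LinearMap.congr_fun hw₁ ⟨w₂, hw₂⟩⟩

theorem IsInvariant.isoContragredient (hB : IsInvariant M₁ M₂ B) (hnd : B.Nondegenerate) :
    IsoContragredient M₁ M₂ := by
  classical
  refine ⟨LinearEquiv.ofBijective (B.codRestrict M₂.gradedDual hB.mem_gradedDual) ⟨?_, ?_⟩, ?_⟩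
  · rw [injective_iff_map_eq_zero]
    intro w₁ hw
    exact hnd.1 w₁ fun w₂ => LinearMap.congr_fun (congr_arg Subtype.val hw) w₂
  · rintro ⟨f, hf⟩
    have hf' : {h : ℂ | ∃ w ∈ M₂.wtSpace h, f w ≠ 0}.Finite := hf
    choose g hg hgf using hB.exists_eq_on_wtSpace hnd f
    -- A functional in the graded dual meets finitely many weights, so its preimages weight by
    -- weight have a finite sum.
    refine ⟨∑ h ∈ hf'.toFinset, g h, Subtype.ext (LinearMap.ext fun w₂ => ?_)⟩
    change B (∑ h ∈ hf'.toFinset, g h) w₂ = f w₂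
    induction w₂ using M₂.wt_induction with
    | hom h w₂ hw₂ =>
      rw [map_sum, LinearMap.sum_apply]
      by_cases hh : h ∈ hf'.toFinset
      · rw [Finset.sum_eq_single_of_mem h hh fun h' _ hne =>
          hB.eq_zero_of_ne (hg h') hw₂ hne, hgf h w₂ hw₂]
      · rw [Finset.sum_eq_zero fun h' hh' =>
          hB.eq_zero_of_ne (hg h') hw₂ fun he => hh (he ▸ hh')]
        by_contra hne
        exact hh (hf'.mem_toFinset.2 ⟨w₂, hw₂, fun h0 => hne h0.symm⟩)
    | add w w' h h' => rw [map_add, h, h', map_add]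
  · intro v n w
    ext w₂
    exact hB v n w w₂

end VOAModule

end VOA

end

theorem mainTheorem5 {V W₁ W₂ : Type*} [AddCommGroup V] [Module ℂ V]
    [AddCommGroup W₁] [Module ℂ W₁] [AddCommGroup W₂] [Module ℂ W₂]
    (𝒱 : VOA.VertexOperatorAlgebra V)
    (form : V →ₗ[ℂ] V →ₗ[ℂ] ℂ)
    (hinv : VOA.VOAModule.IsInvariant 𝒱.adjoint 𝒱.adjoint form)
    (hnondeg : form.Nondegenerate)
    (M₁ : VOA.VOAModule 𝒱 W₁) (M₂ : VOA.VOAModule 𝒱 W₂)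
    (I : VOA.IntertwiningOperator M₁ M₂ 𝒱.adjoint) :
    ∃ B : W₁ →ₗ[ℂ] W₂ →ₗ[ℂ] ℂ,
      (∀ w₁ w₂, B w₁ w₂ = I.contForm form w₁ w₂) ∧
      VOA.VOAModule.IsInvariant M₁ M₂ B ∧
      (M₁.IsIrreducible → M₂.IsIrreducible → I.coeff ≠ 0 →
        B.Nondegenerate ∧ VOA.VOAModule.IsContragredientPair M₁ M₂) := by
  have hB := I.isInvariant_contPairing form
    (VOA.IntertwiningOperator.isVacuumFunctional_form hinv)
  refine ⟨I.contPairing form, fun _ _ => rfl, hB, fun hM₁ hM₂ hI => ?_⟩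
  have hnd := hB.nondegenerate hM₁ hM₂ (I.contPairing_ne_zero hinv hnondeg hI)
  exact ⟨hnd, hB.isoContragredient hnd,
    hB.flip.isoContragredient (LinearMap.flip_nondegenerate.2 hnd)⟩
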